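/- Let $\Omega\subset\mathbb{R}^3$ be a bounded Lipschitz domain with boundary $\Gamma=\partial\Omega$, let $V=H^1(\Omega)$ be the Sobolev space of complex-valued functions, and let $\gamma_0:V\to L^2(\Gamma)$ be the trace operator. Let $(\cdot,\cdot)$ and $(\cdot,\cdot)_\Gamma$ denote the $L^2(\Omega)$ and $L^2(\Gamma)$ scalar products (with complex conjugation on the second argument), with norms $\|\cdot\|$ and $\|\cdot\|_\Gamma$. For $\zeta\in\mathbb{C}$ and $\rho>0$ set $$a_\zeta(u,v)=(\nabla u,\nabla v)+\zeta^2(u,v)+\zeta(\gamma_0u,\gamma_0v)_\Gamma\quad(u,v\in V),\qquad \|u\|_\rho=\left(\|\nabla u\|^2+\rho^2\|u\|^2\right)^{1/2}.$$ Then there is a constant $C>0$, depending only on $\Omega$, such that for every $\zeta\in\mathbb{C}$ with $\operatorname{Re}\zeta>0$ and $|\zeta|\ge 1$ the following hold. 1. The inf-sup constant satisfies $$\gamma_\zeta:=\inf_{u\in V\setminus\{0\}}\ \sup_{v\in V\setminus\{0\}}\frac{|a_\zeta(u,v)|}{\|u\|_{|\zeta|}\,\|v\|_{|\zeta|}}\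 \ge\ \frac{\operatorname{Re}\zeta}{|\zeta|}.$$ 2. For every bounded antilinear functional $F$ on $V$ there is exactly one $u\in V$ with $a_\zeta(u,v)=F(v)$ for all $v\in V$. 3. If $F(v)=(f,v)+(g,\gamma_0v)_\Gamma$ with $f\in L^2(\Omega)$ and $g\in L^2(\Gamma)$, then this solution satisfies $$\|u\|_{|\zeta|}\le\frac{1}{\operatorname{Re}\zeta}\left(\|f\|+C\sqrt{|\zeta|}\,\|g\|_\Gamma\right).$$ -/

import Mathlib

open MeasureTheory Set Filter Topology
open scoped ContDiff ENNReal NNReal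

namespace HelmholtzRobin

noncomputable section

/-- Three-dimensional Euclidean space. -/
abbrev E3 : Type := EuclideanSpace ℝ (Fin 3)

/-- Complex-valued vector fields take values in `ℂ³` with its Hermitian norm. -/
abbrev C3 : Type := EuclideanSpace ℂ (Fin 3)

/-- A bounded Lipschitz domain: a bounded, open, connected (hence non-empty) set which, near each of
its boundary points and in suitable Cartesian coordinates `(y', y₃) ∈ ℝ² × ℝ`, is the set of points
lying strictly above the graph of a Lipschitz function `ψ`. -/
structure IsBoundedLipschitzDomain (Ω : Set E3) : Prop where
  isOpen : IsOpen Ω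
  isConnected : IsConnected Ω
  isBounded : Bornology.IsBounded Ω
  exists_chart : ∀ x ∈ frontier Ω, ∃ (r : ℝ) (e : E3 ≃ₗᵢ[ℝ] WithLp 2 (EuclideanSpace ℝ (Fin 2) × ℝ))
    (ψ : EuclideanSpace ℝ (Fin 2) → ℝ) (K : ℝ≥0), 0 < r ∧ LipschitzWith K ψ ∧
      ∀ y ∈ Metric.ball x r, y ∈ Ω ↔ ψ (e y).fst < (e y).snd

/-- The surface measure on `Γ = ∂Ω`: the normalized two-dimensional Hausdorff measure. -/
def surfaceMeasure (Ω : Set E3) : Measure E3 :=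
  (Measure.euclideanHausdorffMeasure 2 : Measure E3).restrict (frontier Ω)

/-- `L²(Ω)`. -/
abbrev L2 (Ω : Set E3) : Type := Lp ℂ 2 (volume.restrict Ω)

/-- `L²(Ω)³`. -/
abbrev L2Vec (Ω : Set E3) : Type := Lp C3 2 (volume.restrict Ω)

/-- `L²(Γ)`. -/
abbrev L2Bdry (Ω : Set E3) : Type := Lp ℂ 2 (surfaceMeasure Ω)

/-- The partial derivative of `φ` with respect to the `i`-th coordinate. -/
def partialDeriv {F : Type*} [NormedAddCommGroup F] [NormedSpace ℝ F]
    (i : Fin 3) (φ : E3 → F) (x : E3) : F :=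
  fderiv ℝ φ x (EuclideanSpace.single i 1)

/-- The classical gradient of a complex-valued function. -/
def classicalGrad (φ : E3 → ℂ) (x : E3) : C3 :=
  WithLp.toLp 2 (fun i => partialDeriv i φ x)

/-- `G` is the weak gradient of `u` in `Ω`: for each test function `φ ∈ C_c^∞(Ω)` and each `i`,
`∫_Ω u ∂ᵢφ = - ∫_Ω Gᵢ φ`. -/
def IsWeakGradient (Ω : Set E3) (u : E3 → ℂ) (G : E3 → C3) : Prop :=
  ∀ φ : E3 → ℝ, ContDiff ℝ ∞ φ → HasCompactSupport φ → tsupport φ ⊆ Ω → ∀ i : Fin 3,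
    ∫ x in Ω, partialDeriv i φ x • u x = - ∫ x in Ω, φ x • G x i

theorem partialDeriv_continuous {F : Type*} [NormedAddCommGroup F] [NormedSpace ℝ F] {φ : E3 → F}
    (h : ContDiff ℝ ∞ φ) (i : Fin 3) : Continuous (partialDeriv i φ) :=
  (h.continuous_fderiv (by simp)).clm_apply continuous_const

theorem partialDeriv_hasCompactSupport {F : Type*} [NormedAddCommGroup F] [NormedSpace ℝ F]
    {φ : E3 → F} (h : HasCompactSupport φ) (i : Fin 3) :
    HasCompactSupport (partialDeriv i φ) :=
  h.fderiv_apply (𝕜 := ℝ) (EuclideanSpace.single i 1)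

theorem integrable_smul_of_memLp {Ω : Set E3} {φ : E3 → ℝ} (hφ : Continuous φ)
    (hc : HasCompactSupport φ) {u : E3 → ℂ} (hu : MemLp u 2 (volume.restrict Ω)) :
    Integrable (fun x => φ x • u x) (volume.restrict Ω) :=
  memLp_one_iff_integrable.1 (hu.smul (hφ.memLp_of_hasCompactSupport hc (p := 2)))

theorem memLp_coord {Ω : Set E3} {G : E3 → C3} (hG : MemLp G 2 (volume.restrict Ω)) (i : Fin 3) :
    MemLp (fun x => G x i) 2 (volume.restrict Ω) :=
  (EuclideanSpace.proj i : C3 →L[ℂ] ℂ).comp_memLp' hG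

theorem IsWeakGradient.congr {Ω : Set E3} {u v : E3 → ℂ} {G H : E3 → C3}
    (h : IsWeakGradient Ω u G) (huv : u =ᵐ[volume.restrict Ω] v)
    (hGH : G =ᵐ[volume.restrict Ω] H) : IsWeakGradient Ω v H := by
  intro φ h1 h2 h3 i
  have e1 : ∫ x in Ω, partialDeriv i φ x • v x = ∫ x in Ω, partialDeriv i φ x • u x :=
    integral_congr_ae (huv.mono fun x hx => congrArg (partialDeriv i φ x • ·) hx.symm)
  have e2 : ∫ x in Ω, φ x • H x i = ∫ x in Ω, φ x • G x i :=
    integral_congr_ae (hGH.mono fun x hx => congrArg (fun w : C3 => φ x • w i) hx.symm)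
  rw [e1, e2, h φ h1 h2 h3 i]

/-- `V = H¹(Ω)` through weak derivatives: the pairs `(u, ∇u)` with `u ∈ L²(Ω)` whose weak gradient
`∇u` lies in `L²(Ω)³`, normed by `(‖u‖² + ‖∇u‖²)^{1/2}`. (For open `Ω` the weak gradient is determined
by `u`.) -/
def H1 (Ω : Set E3) : Submodule ℂ (WithLp 2 (L2 Ω × L2Vec Ω)) where
  carrier := {p | IsWeakGradient Ω p.fst p.snd}
  zero_mem' := by
    refine IsWeakGradient.congr (u := 0) (G := 0) ?_ (Lp.coeFn_zero _ _ _).symm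
      (Lp.coeFn_zero _ _ _).symm
    intro φ _ _ _ i
    simp
  add_mem' := by
    intro p q hp hq
    refine IsWeakGradient.congr (u := p.fst + q.fst) (G := p.snd + q.snd) ?_
      (Lp.coeFn_add _ _).symm (Lp.coeFn_add _ _).symm
    intro φ h1 h2 h3 i
    have hd := partialDeriv_continuous h1 i
    have hs := partialDeriv_hasCompactSupport h2 i
    simp only [Pi.add_apply, PiLp.add_apply, smul_add]
    rw [integral_add (integrable_smul_of_memLp hd hs (Lp.memLp _))
        (integrable_smul_of_memLp hd hs (Lp.memLp _)),
      integral_add (integrable_smul_of_memLp h1.continuous h2 (memLp_coord (Lp.memLp _) i))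
        (integrable_smul_of_memLp h1.continuous h2 (memLp_coord (Lp.memLp _) i)),
      hp φ h1 h2 h3 i, hq φ h1 h2 h3 i, neg_add]
  smul_mem' := by
    intro c p hp
    refine IsWeakGradient.congr (u := c • ⇑p.fst) (G := c • ⇑p.snd) ?_
      (Lp.coeFn_smul _ _).symm (Lp.coeFn_smul _ _).symm
    intro φ h1 h2 h3 i
    simp only [Pi.smul_apply, PiLp.smul_apply, smul_comm _ c]
    rw [integral_smul, integral_smul, hp φ h1 h2 h3 i, smul_neg]

/-- The embedding `H¹(Ω) → L²(Ω)`, `u ↦ u`. -/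
def val (Ω : Set E3) : H1 Ω →L[ℂ] L2 Ω :=
  (WithLp.fstL 2 ℂ (L2 Ω) (L2Vec Ω)).comp (H1 Ω).subtypeL

/-- The gradient `H¹(Ω) → L²(Ω)³`, `u ↦ ∇u`. -/
def grad (Ω : Set E3) : H1 Ω →L[ℂ] L2Vec Ω :=
  (WithLp.sndL 2 ℂ (L2 Ω) (L2Vec Ω)).comp (H1 Ω).subtypeL

/-- Functions that are smooth up to the boundary, given as smooth compactly supported functions on the
whole space (with square integrable boundary values, which is automatic when `Γ` has finite area, as it
does for a bounded Lipschitz domain). -/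
def SmoothFun (Ω : Set E3) : Submodule ℂ (E3 → ℂ) where
  carrier := {φ | ContDiff ℝ ∞ φ ∧ HasCompactSupport φ ∧ MemLp φ 2 (surfaceMeasure Ω)}
  zero_mem' := ⟨contDiff_const, HasCompactSupport.zero, MemLp.zero⟩
  add_mem' := fun hf hg => ⟨hf.1.add hg.1, hf.2.1.add hg.2.1, hf.2.2.add hg.2.2⟩
  smul_mem' := fun c _ hf => ⟨hf.1.const_smul c, hf.2.1.smul_left,
    hf.2.2.const_smul c⟩

theorem memLp_smooth {Ω : Set E3} (φ : SmoothFun Ω) : MemLp (φ : E3 → ℂ) 2 (volume.restrict Ω) :=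
  φ.2.1.continuous.memLp_of_hasCompactSupport φ.2.2.1

theorem memLp_classicalGrad {Ω : Set E3} (φ : SmoothFun Ω) :
    MemLp (classicalGrad φ) 2 (volume.restrict Ω) := by
  have hc : Continuous (classicalGrad φ) :=
    (PiLp.continuous_toLp 2 _).comp (continuous_pi fun i => partialDeriv_continuous φ.2.1 i)
  refine hc.memLp_of_hasCompactSupport ?_
  have h : HasCompactSupport (fderiv ℝ (φ : E3 → ℂ)) := φ.2.2.1.fderiv (𝕜 := ℝ)
  refine h.mono fun x hx => ?_
  contrapose! hx
  simp only [Function.mem_support, not_not] at hx ⊢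
  ext i
  simp [classicalGrad, partialDeriv, hx]

theorem isWeakGradient_classicalGrad {Ω : Set E3} (φ : SmoothFun Ω) :
    IsWeakGradient Ω φ (classicalGrad φ) := by
  intro η h1 h2 h3 i
  have e1 : ∫ x in Ω, partialDeriv i η x • (φ : E3 → ℂ) x
      = ∫ x, partialDeriv i η x • (φ : E3 → ℂ) x := by
    refine setIntegral_eq_integral_of_forall_compl_eq_zero fun x hx => ?_
    have : x ∉ tsupport (fderiv ℝ η) := fun h => hx (h3 (tsupport_fderiv_subset ℝ h))
    simp [partialDeriv, image_eq_zero_of_notMem_tsupport this]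
  have e2 : ∫ x in Ω, η x • classicalGrad φ x i
      = ∫ x, η x • fderiv ℝ (φ : E3 → ℂ) x (EuclideanSpace.single i 1) := by
    refine setIntegral_eq_integral_of_forall_compl_eq_zero fun x hx => ?_
    simp [image_eq_zero_of_notMem_tsupport fun h => hx (h3 h)]
  rw [e1, e2, eq_neg_iff_add_eq_zero, add_comm, ← eq_neg_iff_add_eq_zero]
  have hφ := φ.2.1
  have dφ := partialDeriv_continuous hφ i
  have dη := partialDeriv_continuous h1 i
  refine integral_smul_fderiv_eq_neg_fderiv_smul_of_integrable (f := η) (g := (φ : E3 → ℂ))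
    (v := EuclideanSpace.single i 1) ?_ ?_ ?_ ?_ ?_
  · exact (dη.smul hφ.continuous).integrable_of_hasCompactSupport
      ((partialDeriv_hasCompactSupport h2 i).smul_right)
  · exact (h1.continuous.smul dφ).integrable_of_hasCompactSupport h2.smul_right
  · exact (h1.continuous.smul hφ.continuous).integrable_of_hasCompactSupport h2.smul_right
  · exact fun x _ => (h1.differentiable (by simp)).differentiableAt
  · exact fun x _ => (hφ.differentiable (by simp)).differentiableAt

theorem classicalGrad_add {Ω : Set E3} (φ η : SmoothFun Ω) :
    classicalGrad (φ + η : SmoothFun Ω) = classicalGrad φ + classicalGrad η := by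
  funext x
  ext i
  have h1 : DifferentiableAt ℝ (φ : E3 → ℂ) x := (φ.2.1.differentiable (by simp)).differentiableAt
  have h2 : DifferentiableAt ℝ (η : E3 → ℂ) x := (η.2.1.differentiable (by simp)).differentiableAt
  simp [classicalGrad, partialDeriv, fderiv_add h1 h2]

theorem classicalGrad_smul {Ω : Set E3} (c : ℂ) (φ : SmoothFun Ω) :
    classicalGrad (c • φ : SmoothFun Ω) = c • classicalGrad φ := by
  funext x
  ext i
  have h1 : DifferentiableAt ℝ (φ : E3 → ℂ) x := (φ.2.1.differentiable (by simp)).differentiableAt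
  simp [classicalGrad, partialDeriv, fderiv_const_smul h1 c]

/-- The restriction `φ ↦ φ|_Ω ∈ H¹(Ω)` of smooth functions. -/
def smoothToH1 (Ω : Set E3) : SmoothFun Ω →ₗ[ℂ] H1 Ω where
  toFun φ := ⟨WithLp.toLp 2 ((memLp_smooth φ).toLp φ, (memLp_classicalGrad φ).toLp _),
    (isWeakGradient_classicalGrad φ).congr (memLp_smooth φ).coeFn_toLp.symm
      (memLp_classicalGrad φ).coeFn_toLp.symm⟩
  map_add' φ η := by
    apply Subtype.ext
    apply WithLp.ofLp_injective
    refine Prod.ext ?_ ?_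
    · exact (memLp_smooth φ).toLp_add (memLp_smooth η)
    · exact (MemLp.toLp_congr (memLp_classicalGrad (φ + η)) ((memLp_classicalGrad φ).add (memLp_classicalGrad η))
        (Eventually.of_forall fun x => by rw [classicalGrad_add])).trans
        ((memLp_classicalGrad φ).toLp_add (memLp_classicalGrad η))
  map_smul' c φ := by
    apply Subtype.ext
    apply WithLp.ofLp_injective
    refine Prod.ext ?_ ?_
    · exact (memLp_smooth φ).toLp_const_smul c
    · exact (MemLp.toLp_congr (memLp_classicalGrad (c • φ)) ((memLp_classicalGrad φ).const_smul c)
        (Eventually.of_forall fun x => by rw [classicalGrad_smul])).trans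
        ((memLp_classicalGrad φ).toLp_const_smul c)

/-- The pointwise restriction `φ ↦ φ|_Γ ∈ L²(Γ)` of smooth functions. -/
def smoothToBdry (Ω : Set E3) : SmoothFun Ω →ₗ[ℂ] L2Bdry Ω where
  toFun φ := φ.2.2.2.toLp φ
  map_add' φ η := φ.2.2.2.toLp_add η.2.2.2
  map_smul' c φ := φ.2.2.2.toLp_const_smul c

/-- The trace operator `γ₀ : H¹(Ω) → L²(Γ)`: the continuous extension to `H¹(Ω)` of the restriction
`φ|_Ω ↦ φ|_Γ` of smooth functions. (For a bounded Lipschitz domain, these functions are dense in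
`H¹(Ω)` and `‖φ‖_Γ ≤ C ‖φ‖_{H¹(Ω)}`, so that the extension exists and is unique.) -/
def trace (Ω : Set E3) : H1 Ω →L[ℂ] L2Bdry Ω :=
  (smoothToBdry Ω).extendOfNorm (smoothToH1 Ω)

/-- The norm `‖u‖_ρ = (‖∇u‖² + ρ² ‖u‖²)^{1/2}` on `H¹(Ω)`. -/
def weightedNorm (Ω : Set E3) (ρ : ℝ) (u : H1 Ω) : ℝ :=
  Real.sqrt (‖grad Ω u‖ ^ 2 + ρ ^ 2 * ‖val Ω u‖ ^ 2)

/-- The sesquilinear form `a_ζ(u, v) = (∇u, ∇v) + ζ² (u, v) + ζ (γ₀ u, γ₀ v)_Γ`, where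
`(f, g) = ∫ f ḡ`, which is `inner ℂ g f` in Mathlib's convention. -/
def robinForm (Ω : Set E3) (ζ : ℂ) (u v : H1 Ω) : ℂ :=
  inner ℂ (grad Ω v) (grad Ω u) + ζ ^ 2 * inner ℂ (val Ω v) (val Ω u)
    + ζ * inner ℂ (trace Ω v) (trace Ω u)

/-- The inf-sup constant of `a_ζ` with respect to `‖·‖_{|ζ|}`, the infimum and supremum being taken
over non-zero functions in `H¹(Ω)`. -/
def infSupConst (Ω : Set E3) (ζ : ℂ) : ℝ≥0∞ :=
  ⨅ u : {u : H1 Ω // u ≠ 0}, ⨆ v : {v : H1 Ω // v ≠ 0},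
    ENNReal.ofReal (‖robinForm Ω ζ u v‖ / (weightedNorm Ω ‖ζ‖ u * weightedNorm Ω ‖ζ‖ v))

/-- `u` solves the variational problem `a_ζ(u, v) = F(v)` for all `v ∈ H¹(Ω)`; here `F` is a bounded
antilinear functional on `H¹(Ω)`. -/
def IsSolution (Ω : Set E3) (ζ : ℂ) (F : H1 Ω →L⋆[ℂ] ℂ) (u : H1 Ω) : Prop :=
  ∀ v : H1 Ω, robinForm Ω ζ u v = F v

/-- The functional `v ↦ (f, v) + (g, γ₀ v)_Γ`. -/
def dataFunctional (Ω : Set E3) (f : L2 Ω) (g : L2Bdry Ω) : H1 Ω →L⋆[ℂ] ℂ :=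
  ((innerSL ℂ).flip f).comp (val Ω) + ((innerSL ℂ).flip g).comp (trace Ω)

theorem dataFunctional_apply (Ω : Set E3) (f : L2 Ω) (g : L2Bdry Ω) (v : H1 Ω) :
    dataFunctional Ω f g v = inner ℂ (val Ω v) f + inner ℂ (trace Ω v) g :=
  rfl

end

end HelmholtzRobin

namespace HelmholtzRobin

/-! Multiplying a_ζ(u,u) by the conjugate of ζ and taking real parts gives Re ζ ‖u‖²_{|ζ|} + |ζ|²
‖γ₀u‖²_Γ, so Re ζ ‖u‖²_{|ζ|} ≤ |ζ| |a_ζ(u,u)| (`re_mul_weightedNorm_sq_le`). Choosing v = u yields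
the inf-sup bound, and Lax–Milgram on the complete space `H1 Ω` yields unique solvability. For the a
priori bound, test with u and control the boundary datum by the multiplicative trace inequality
‖γ₀u‖² ≤ C(‖u‖² + ‖u‖‖∇u‖), which turns |ζ|‖γ₀u‖ into √(2C|ζ|) ‖u‖_{|ζ|}.

The analytic work is that inequality. For smooth functions it follows by integrating χ|φ|² along
vertical lines in Lipschitz charts (`exists_local_trace_bound`). It passes to `H1 Ω` because smooth
functions are dense (`denseRange_smoothToH1`): cut off by a partition of unity and mollify with a
kernel shifted into the domain. Density and boundedness are also what identify `trace` with
restriction on smooth functions. -/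

/-! ### Completeness of H¹(Ω). -/

theorem integral_smul_Lp_eq_inner {Ω : Set E3} {φ : E3 → ℝ} (hφ : Continuous φ)
    (hc : HasCompactSupport φ) :
    ∃ w : L2 Ω, ∀ u : L2 Ω, ∫ x in Ω, φ x • u x = inner ℂ w u := by
  have hm : MemLp (fun x => (φ x : ℂ)) 2 (volume.restrict Ω) :=
    (Complex.continuous_ofReal.comp hφ).memLp_of_hasCompactSupport
      (hc.comp_left (g := fun t : ℝ => (t : ℂ)) (by simp))
  refine ⟨hm.toLp _, fun u => ?_⟩
  rw [L2.inner_def]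
  refine integral_congr_ae ?_
  filter_upwards [hm.coeFn_toLp] with x hx
  rw [hx]
  simp [mul_comm]

theorem continuous_integral_smul_Lp {Ω : Set E3} {φ : E3 → ℝ} (hφ : Continuous φ)
    (hc : HasCompactSupport φ) : Continuous (fun u : L2 Ω => ∫ x in Ω, φ x • u x) := by
  obtain ⟨w, hw⟩ := integral_smul_Lp_eq_inner (Ω := Ω) hφ hc
  simp only [hw]
  fun_prop

theorem continuous_integral_smul_coord {Ω : Set E3} {φ : E3 → ℝ} (hφ : Continuous φ)
    (hc : HasCompactSupport φ) (i : Fin 3) :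
    Continuous (fun G : L2Vec Ω => ∫ x in Ω, φ x • G x i) := by
  have h := (continuous_integral_smul_Lp (Ω := Ω) hφ hc).comp
    ((EuclideanSpace.proj i : C3 →L[ℂ] ℂ).compLpL 2 (volume.restrict Ω)).continuous
  refine h.congr fun G => integral_congr_ae ?_
  filter_upwards [(EuclideanSpace.proj i : C3 →L[ℂ] ℂ).coeFn_compLpL G] with x hx
  simp only [hx]
  rfl

/-- Each test function imposes an equality of two L²-continuous functionals. The resulting
completeness is needed for adjoints and Riesz representation. -/
theorem isClosed_H1 (Ω : Set E3) : IsClosed (H1 Ω : Set (WithLp 2 (L2 Ω × L2Vec Ω))) := by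
  have h : (H1 Ω : Set (WithLp 2 (L2 Ω × L2Vec Ω))) =
      {p | ∀ φ : E3 → ℝ, ContDiff ℝ ∞ φ → HasCompactSupport φ → tsupport φ ⊆ Ω → ∀ i : Fin 3,
        ∫ x in Ω, partialDeriv i φ x • p.fst x = - ∫ x in Ω, φ x • p.snd x i} := rfl
  rw [h]
  simp only [ofPred_forall]
  refine isClosed_iInter fun φ => isClosed_iInter fun h1 => isClosed_iInter fun h2 =>
    isClosed_iInter fun h3 => isClosed_iInter fun i => isClosed_eq ?_ ?_
  · exact (continuous_integral_smul_Lp (partialDeriv_continuous h1 i)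
      (partialDeriv_hasCompactSupport h2 i)).comp (WithLp.fstL 2 ℂ (L2 Ω) (L2Vec Ω)).continuous
  · exact ((continuous_integral_smul_coord h1.continuous h2 i).comp
      (WithLp.sndL 2 ℂ (L2 Ω) (L2Vec Ω)).continuous).neg

instance completeSpace_H1 (Ω : Set E3) : CompleteSpace (H1 Ω) :=
  (isClosed_H1 Ω).completeSpace_coe

/-! ### Coercivity, solvability and the a priori bound. -/

theorem norm_sq_eq (Ω : Set E3) (u : H1 Ω) : ‖u‖ ^ 2 = ‖val Ω u‖ ^ 2 + ‖grad Ω u‖ ^ 2 :=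
  WithLp.prod_norm_sq_eq_of_L2 (u : WithLp 2 (L2 Ω × L2Vec Ω))

theorem weightedNorm_sq (Ω : Set E3) (ρ : ℝ) (u : H1 Ω) :
    weightedNorm Ω ρ u ^ 2 = ‖grad Ω u‖ ^ 2 + ρ ^ 2 * ‖val Ω u‖ ^ 2 :=
  Real.sq_sqrt (by positivity)

theorem norm_le_weightedNorm (Ω : Set E3) {ρ : ℝ} (hρ : 1 ≤ ρ) (u : H1 Ω) :
    ‖u‖ ≤ weightedNorm Ω ρ u := by
  refine Real.le_sqrt_of_sq_le ?_
  rw [norm_sq_eq]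
  nlinarith [mul_le_mul_of_nonneg_right (one_le_pow₀ hρ (n := 2)) (sq_nonneg ‖val Ω u‖)]

theorem mul_norm_val_le_weightedNorm (Ω : Set E3) (ρ : ℝ) (u : H1 Ω) :
    ρ * ‖val Ω u‖ ≤ weightedNorm Ω ρ u := by
  refine Real.le_sqrt_of_sq_le ?_
  rw [mul_pow]
  linarith [sq_nonneg ‖grad Ω u‖]

theorem norm_grad_le_weightedNorm (Ω : Set E3) (ρ : ℝ) (u : H1 Ω) :
    ‖grad Ω u‖ ≤ weightedNorm Ω ρ u := by
  refine Real.le_sqrt_of_sq_le ?_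
  have : 0 ≤ ρ ^ 2 * ‖val Ω u‖ ^ 2 := by positivity
  linarith

theorem robinForm_self (Ω : Set E3) (ζ : ℂ) (u : H1 Ω) :
    robinForm Ω ζ u u = ((‖grad Ω u‖ ^ 2 : ℝ) : ℂ) + ζ ^ 2 * ((‖val Ω u‖ ^ 2 : ℝ) : ℂ)
      + ζ * ((‖trace Ω u‖ ^ 2 : ℝ) : ℂ) := by
  simp only [robinForm, inner_self_eq_norm_sq_to_K]
  push_cast
  rfl

/-- After multiplication by the conjugate of ζ the coefficients 1, ζ², ζ have real parts Re ζ, |ζ|²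
Re ζ, |ζ|². The boundary term is nonnegative and is dropped. -/
theorem re_mul_weightedNorm_sq_le (Ω : Set E3) (ζ : ℂ) (u : H1 Ω) :
    ζ.re * weightedNorm Ω ‖ζ‖ u ^ 2 ≤ ‖ζ‖ * ‖robinForm Ω ζ u u‖ := by
  have h1 : (starRingEnd ℂ ζ * robinForm Ω ζ u u).re
      = ζ.re * ‖grad Ω u‖ ^ 2 + ‖ζ‖ ^ 2 * ζ.re * ‖val Ω u‖ ^ 2 + ‖ζ‖ ^ 2 * ‖trace Ω u‖ ^ 2 := by
    rw [robinForm_self, Complex.sq_norm, Complex.normSq_apply]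
    simp only [Complex.mul_re, Complex.mul_im, Complex.add_re, Complex.add_im, Complex.conj_re,
      Complex.conj_im, Complex.ofReal_re, Complex.ofReal_im, pow_two]
    ring
  have h2 := Complex.re_le_norm (starRingEnd ℂ ζ * robinForm Ω ζ u u)
  rw [norm_mul, RCLike.norm_conj, h1] at h2
  rw [weightedNorm_sq]
  have : 0 ≤ ‖ζ‖ ^ 2 * ‖trace Ω u‖ ^ 2 := by positivity
  linarith

/-- The operator representing the Robin form. -/
noncomputable def robinOp (Ω : Set E3) (ζ : ℂ) : H1 Ω →L[ℂ] H1 Ω :=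
  ContinuousLinearMap.adjoint (grad Ω) ∘L grad Ω
    + ζ ^ 2 • (ContinuousLinearMap.adjoint (val Ω) ∘L val Ω)
    + ζ • (ContinuousLinearMap.adjoint (trace Ω) ∘L trace Ω)

theorem inner_robinOp (Ω : Set E3) (ζ : ℂ) (u v : H1 Ω) :
    inner ℂ v (robinOp Ω ζ u) = robinForm Ω ζ u v := by
  simp [robinOp, robinForm, ContinuousLinearMap.adjoint_inner_right]

theorem weightedNorm_pos (Ω : Set E3) {ρ : ℝ} (hρ : 1 ≤ ρ) {u : H1 Ω} (hu : u ≠ 0) :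
    0 < weightedNorm Ω ρ u :=
  (norm_pos_iff.2 hu).trans_le (norm_le_weightedNorm Ω hρ u)

/-- Lax–Milgram: since |ζ| ≥ 1 the weighted norm dominates the H¹ norm, so the operator is coercive
with constant Re ζ / |ζ|. -/
theorem isUnit_robinOp (Ω : Set E3) {ζ : ℂ} (h0 : 0 < ζ.re) (h1 : 1 ≤ ‖ζ‖) :
    IsUnit (robinOp Ω ζ) := by
  have hζ : 0 < ‖ζ‖ := by linarith
  refine ContinuousLinearMap.isUnit_of_forall_le_norm_inner_map _
    (c := Real.toNNReal (ζ.re / ‖ζ‖)) (Real.toNNReal_pos.2 (div_pos h0 hζ)) fun u => ?_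
  rw [norm_inner_symm, inner_robinOp, Real.coe_toNNReal _ (by positivity)]
  rw [← mul_div_assoc, div_le_iff₀ hζ, mul_comm _ ‖ζ‖, mul_comm _ ζ.re]
  refine le_trans ?_ (re_mul_weightedNorm_sq_le Ω ζ u)
  gcongr
  exact norm_le_weightedNorm Ω h1 u

theorem existsUnique_isSolution (Ω : Set E3) {ζ : ℂ} (h0 : 0 < ζ.re) (h1 : 1 ≤ ‖ζ‖)
    (F : H1 Ω →L⋆[ℂ] ℂ) : ∃! u : H1 Ω, IsSolution Ω ζ F u := by
  have hb : Function.Bijective (robinOp Ω ζ) :=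
    ContinuousLinearMap.isUnit_iff_bijective.1 (isUnit_robinOp Ω h0 h1)
  -- Riesz representation applies to linear functionals, so the antilinear `F` is conjugated first.
  let F' : H1 Ω →L[ℂ] ℂ := (starL ℂ : ℂ ≃L⋆[ℂ] ℂ).toContinuousLinearMap.comp F
  have hF : ∀ v, inner ℂ v ((InnerProductSpace.toDual ℂ (H1 Ω)).symm F') = F v := fun v => by
    rw [← inner_conj_symm (𝕜 := ℂ) v, InnerProductSpace.toDual_symm_apply]
    simp [F']
  have key : ∀ u, IsSolution Ω ζ F u ↔
      robinOp Ω ζ u = (InnerProductSpace.toDual ℂ (H1 Ω)).symm F' := fun u => by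
    rw [ext_iff_inner_left ℂ]
    simp only [IsSolution, hF, inner_robinOp]
  simp only [key]
  exact hb.existsUnique _

theorem le_infSupConst (Ω : Set E3) {ζ : ℂ} (h1 : 1 ≤ ‖ζ‖) :
    ENNReal.ofReal (ζ.re / ‖ζ‖) ≤ infSupConst Ω ζ := by
  have hζ : 0 < ‖ζ‖ := by linarith
  refine le_iInf fun u => le_trans ?_ (le_iSup _ u)
  have hu := weightedNorm_pos Ω h1 u.2
  refine ENNReal.ofReal_le_ofReal ?_
  rw [div_le_div_iff₀ hζ (by positivity), ← pow_two, mul_comm _ ‖ζ‖]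
  exact re_mul_weightedNorm_sq_le Ω ζ u

theorem weightedNorm_le_of_isSolution (Ω : Set E3) {C : ℝ} (hC : 0 < C)
    (hT : ∀ u : H1 Ω, ‖trace Ω u‖ ^ 2 ≤ C * (‖val Ω u‖ ^ 2 + ‖val Ω u‖ * ‖grad Ω u‖))
    {ζ : ℂ} (h0 : 0 < ζ.re) (h1 : 1 ≤ ‖ζ‖) (f : L2 Ω) (g : L2Bdry Ω) (u : H1 Ω)
    (hu : IsSolution Ω ζ (dataFunctional Ω f g) u) :
    weightedNorm Ω ‖ζ‖ u ≤ (1 / ζ.re) * (‖f‖ + Real.sqrt (2 * C) * Real.sqrt ‖ζ‖ * ‖g‖) := by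
  set ρ := ‖ζ‖ with hρ
  set N := weightedNorm Ω ρ u with hN
  have hρ0 : 0 < ρ := by linarith
  have hN0 : 0 ≤ N := Real.sqrt_nonneg _
  have hv := mul_norm_val_le_weightedNorm Ω ρ u
  have hg := norm_grad_le_weightedNorm Ω ρ u
  -- Both terms of the trace inequality, times ρ², are at most ρN²; the first one uses ρ ≥ 1. Hence
  -- the factor 2C.
  have ht : ρ * ‖trace Ω u‖ ≤ Real.sqrt (2 * C) * Real.sqrt ρ * N := by
    have e : Real.sqrt (2 * C) * Real.sqrt ρ * N = Real.sqrt (2 * C * ρ * N ^ 2) := by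
      rw [Real.sqrt_mul' _ (sq_nonneg N), Real.sqrt_mul' _ hρ0.le, Real.sqrt_sq hN0]
    rw [e]
    refine Real.le_sqrt_of_sq_le ?_
    have a1 : ρ ^ 2 * ‖val Ω u‖ ^ 2 ≤ ρ * N ^ 2 := by
      have : (ρ * ‖val Ω u‖) ^ 2 ≤ N ^ 2 := pow_le_pow_left₀ (by positivity) hv 2
      nlinarith [sq_nonneg N]
    have a2 : ρ ^ 2 * (‖val Ω u‖ * ‖grad Ω u‖) ≤ ρ * N ^ 2 := by
      have : (ρ * ‖val Ω u‖) * ‖grad Ω u‖ ≤ N * N := mul_le_mul hv hg (norm_nonneg _) hN0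
      nlinarith
    have a3 := mul_le_mul_of_nonneg_left (hT u) (sq_nonneg ρ)
    nlinarith
  have hb : ρ * ‖robinForm Ω ζ u u‖ ≤ (‖f‖ + Real.sqrt (2 * C) * Real.sqrt ρ * ‖g‖) * N := by
    rw [hu u, dataFunctional_apply]
    calc ρ * ‖inner ℂ (val Ω u) f + inner ℂ (trace Ω u) g‖
        ≤ ρ * (‖val Ω u‖ * ‖f‖ + ‖trace Ω u‖ * ‖g‖) := by
          gcongr
          exact (norm_add_le _ _).trans (add_le_add (norm_inner_le_norm _ _)
            (norm_inner_le_norm _ _))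
      _ = (ρ * ‖val Ω u‖) * ‖f‖ + (ρ * ‖trace Ω u‖) * ‖g‖ := by ring
      _ ≤ N * ‖f‖ + (Real.sqrt (2 * C) * Real.sqrt ρ * N) * ‖g‖ := by gcongr
      _ = _ := by ring
  have hc := (re_mul_weightedNorm_sq_le Ω ζ u).trans hb
  rw [one_div, inv_mul_eq_div, le_div_iff₀ h0]
  -- The estimate is obtained multiplied by N, so N = 0 is treated apart.
  rcases hN0.eq_or_lt with h | h
  · rw [← h, zero_mul]; positivity
  · refine le_of_mul_le_mul_right ?_ h
    rw [← hN] at hc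
    linarith

/-! ### The multiplicative trace inequality for smooth functions. -/

/-- The parametrization of the graph of `ψ` in the coordinates `e`. -/
noncomputable def graphMap (e : E3 ≃ₗᵢ[ℝ] WithLp 2 (EuclideanSpace ℝ (Fin 2) × ℝ))
    (ψ : EuclideanSpace ℝ (Fin 2) → ℝ) (y : EuclideanSpace ℝ (Fin 2)) : E3 :=
  e.symm (WithLp.toLp 2 (y, ψ y))

theorem lipschitzWith_graphMap (e : E3 ≃ₗᵢ[ℝ] WithLp 2 (EuclideanSpace ℝ (Fin 2) × ℝ))
    {ψ : EuclideanSpace ℝ (Fin 2) → ℝ} {K : ℝ≥0} (hψ : LipschitzWith K ψ) :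
    LipschitzWith (1 + K) (graphMap e ψ) := by
  refine LipschitzWith.of_dist_le_mul fun y z => ?_
  rw [graphMap, graphMap, e.symm.dist_map, WithLp.prod_dist_eq_of_L2]
  refine Real.sqrt_le_iff.2 ⟨by positivity, ?_⟩
  have h := hψ.dist_le_mul y z
  have h0 : 0 ≤ (K : ℝ) := K.2
  have h1 : 0 ≤ dist y z := dist_nonneg
  have h2 : dist (ψ y) (ψ z) ^ 2 ≤ (K * dist y z) ^ 2 := pow_le_pow_left₀ dist_nonneg h 2
  have h3 : 0 ≤ (K : ℝ) * dist y z ^ 2 := by positivity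
  change dist y z ^ 2 + dist (ψ y) (ψ z) ^ 2 ≤ ((1 + (K : ℝ)) * dist y z) ^ 2
  nlinarith

theorem euclideanHausdorffMeasure_image_le {X Y : Type*} [EMetricSpace X] [MeasurableSpace X]
    [BorelSpace X] [EMetricSpace Y] [MeasurableSpace Y] [BorelSpace Y] {f : X → Y} {K : ℝ≥0}
    (hf : LipschitzWith K f) (d : ℕ) (s : Set X) :
    (Measure.euclideanHausdorffMeasure d : Measure Y) (f '' s)
      ≤ K ^ d * (Measure.euclideanHausdorffMeasure d : Measure X) s := by
  have h := hf.hausdorffMeasure_image_le (d := d) (Nat.cast_nonneg d) s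
  rw [ENNReal.rpow_natCast] at h
  simp only [Measure.euclideanHausdorffMeasure_def, Measure.smul_apply, ENNReal.smul_def,
    smul_eq_mul]
  rw [mul_left_comm]
  gcongr

/-- Only an upper bound on the area of a graph is needed, so the Lipschitz estimate for Hausdorff
measure replaces the area formula. -/
theorem restrict_range_graphMap_le (e : E3 ≃ₗᵢ[ℝ] WithLp 2 (EuclideanSpace ℝ (Fin 2) × ℝ))
    {ψ : EuclideanSpace ℝ (Fin 2) → ℝ} {K : ℝ≥0} (hψ : LipschitzWith K ψ) :
    (Measure.euclideanHausdorffMeasure 2 : Measure E3).restrict (range (graphMap e ψ))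
      ≤ ((1 + K) ^ 2 : ℝ≥0) • volume.map (graphMap e ψ) := by
  have hL := lipschitzWith_graphMap e hψ
  refine Measure.le_iff.2 fun s hs => ?_
  rw [Measure.restrict_apply hs, Measure.smul_apply, Measure.map_apply hL.continuous.measurable hs,
    ← image_preimage_eq_inter_range, ← EuclideanSpace.euclideanHausdorffMeasure_eq_volume]
  refine (euclideanHausdorffMeasure_image_le hL 2 _).trans (le_of_eq ?_)
  simp [ENNReal.smul_def]

/-- A boundary point is not above the graph because Ω is open, and not below it because a
neighbourhood would then miss Ω. -/
theorem frontier_inter_ball_subset {Ω : Set E3} (hΩ : IsOpen Ω) {x : E3} {r : ℝ}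
    {e : E3 ≃ₗᵢ[ℝ] WithLp 2 (EuclideanSpace ℝ (Fin 2) × ℝ)}
    {ψ : EuclideanSpace ℝ (Fin 2) → ℝ} (hψ : Continuous ψ)
    (hc : ∀ y ∈ Metric.ball x r, y ∈ Ω ↔ ψ (e y).fst < (e y).snd) :
    frontier Ω ∩ Metric.ball x r ⊆ range (graphMap e ψ) := by
  rintro y ⟨hy, hyr⟩
  rw [hΩ.frontier_eq] at hy
  refine ⟨(e y).fst, ?_⟩
  have c1 : Continuous fun z : E3 => (e z).fst :=
    (WithLp.prod_continuous_ofLp 2 _ _).fst.comp e.continuous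
  have c2 : Continuous fun z : E3 => (e z).snd :=
    (WithLp.prod_continuous_ofLp 2 _ _).snd.comp e.continuous
  have h1 : (e y).snd ≤ ψ (e y).fst := not_lt.1 fun h => hy.2 ((hc y hyr).2 h)
  have h2 : ψ (e y).fst ≤ (e y).snd := by
    by_contra! h
    have hU : IsOpen {z : E3 | (e z).snd < ψ (e z).fst} := isOpen_lt c2 (hψ.comp c1)
    obtain ⟨z, ⟨hz1, hz2⟩, hz⟩ := mem_closure_iff.1 hy.1 _ (hU.inter Metric.isOpen_ball) ⟨h, hyr⟩
    exact lt_asymm ((hc z hz2).1 hz) hz1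
  rw [graphMap, LinearIsometryEquiv.symm_apply_eq, ← h1.antisymm h2]
  rfl

theorem lintegral_comp_chart (e : E3 ≃ₗᵢ[ℝ] WithLp 2 (EuclideanSpace ℝ (Fin 2) × ℝ))
    {Q : E3 → ℝ≥0∞} (hQ : Measurable Q) :
    ∫⁻ y, ∫⁻ t, Q (e.symm (WithLp.toLp 2 (y, t))) = ∫⁻ x, Q x := by
  have hm : Measurable fun p : EuclideanSpace ℝ (Fin 2) × ℝ => Q (e.symm (WithLp.toLp 2 p)) :=
    hQ.comp (e.symm.continuous.measurable.comp (WithLp.prod_continuous_toLp 2 _ _).measurable)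
  rw [← lintegral_prod (fun p : EuclideanSpace ℝ (Fin 2) × ℝ => Q (e.symm (WithLp.toLp 2 p)))
    hm.aemeasurable, ← Measure.volume_eq_prod,
    (WithLp.volume_preserving_toLp (EuclideanSpace ℝ (Fin 2)) ℝ).lintegral_comp
      (f := fun p => Q (e.symm p)) (hQ.comp e.symm.continuous.measurable),
    e.symm.measurePreserving.lintegral_comp hQ]

/-- Fundamental theorem of calculus along the vertical ray from the graph into Ω; compact support
removes the contribution at infinity. -/
theorem enorm_graphMap_le {Ω : Set E3} {x : E3} {r : ℝ}
    {e : E3 ≃ₗᵢ[ℝ] WithLp 2 (EuclideanSpace ℝ (Fin 2) × ℝ)} {ψ : EuclideanSpace ℝ (Fin 2) → ℝ}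
    (hc : ∀ y ∈ Metric.ball x r, y ∈ Ω ↔ ψ (e y).fst < (e y).snd)
    {g : E3 → ℝ} (hg : ContDiff ℝ 1 g) (hgc : HasCompactSupport g)
    (hgs : tsupport g ⊆ Metric.ball x r) (y : EuclideanSpace ℝ (Fin 2)) :
    ‖g (graphMap e ψ y)‖ₑ ≤ ∫⁻ t : ℝ, Ω.indicator
      (fun x => ‖fderiv ℝ g x (e.symm (WithLp.toLp 2 (0, 1)))‖ₑ)
      (e.symm (WithLp.toLp 2 (y, t))) := by
  set n : E3 := e.symm (WithLp.toLp 2 (0, 1)) with hn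
  have hline : ∀ s : ℝ, e.symm (WithLp.toLp 2 (y, ψ y - s)) = graphMap e ψ y - s • n := fun s => by
    rw [graphMap, hn, ← map_smul, ← map_sub, ← WithLp.toLp_smul, ← WithLp.toLp_sub]
    simp
  have hn0 : n ≠ 0 := by
    rw [hn, Ne, e.symm.map_eq_zero_iff]
    intro h
    simpa using congrArg WithLp.snd h
  have hd : ∀ s, HasDerivAt (fun s : ℝ => graphMap e ψ y - s • n) (-n) s := fun s => by
    simpa using ((hasDerivAt_id s).smul_const n).const_sub (graphMap e ψ y)
  have hcl : Topology.IsClosedEmbedding fun s : ℝ => graphMap e ψ y - s • n := by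
    have := (Homeomorph.subLeft (graphMap e ψ y)).isClosedEmbedding.comp
      (isClosedEmbedding_smul_left (𝕜 := ℝ) hn0)
    exact this
  -- The integral runs over s ≤ 0, and the parametrization by −s makes this the upward ray.
  have h := HasCompactSupport.enorm_le_lintegral_Ici_deriv
    (f := fun s : ℝ => g (graphMap e ψ y - s • n)) (hg.comp (by fun_prop))
    (hgc.comp_isClosedEmbedding hcl) 0
  rw [zero_smul, sub_zero] at h
  refine h.trans ?_
  -- The endpoint s = 0 lies on the graph, hence outside Ω, and is discarded as a null set.
  rw [← setLIntegral_congr Iio_ae_eq_Iic, ← lintegral_indicator measurableSet_Iio,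
    
    ← lintegral_sub_left_eq_self (fun t => Ω.indicator _ (e.symm (WithLp.toLp 2 (y, t)))) (ψ y)]
  refine lintegral_mono fun s => ?_
  rw [hline, indicator_apply]
  split_ifs with hs
  swap
  · exact zero_le
  have hder : deriv (fun s : ℝ => g (graphMap e ψ y - s • n)) s
      = - fderiv ℝ g (graphMap e ψ y - s • n) n := by
    have := ((hg.differentiable one_ne_zero).differentiableAt.hasFDerivAt.comp_hasDerivAt s (hd s))
    exact this.deriv.trans (map_neg _ _)
  rw [hder, enorm_neg]
  by_cases hz : fderiv ℝ g (graphMap e ψ y - s • n) = 0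
  · simp [hz]
  have hmem : graphMap e ψ y - s • n ∈ Metric.ball x r :=
    hgs (support_fderiv_subset ℝ hz)
  rw [indicator_of_mem]
  rw [hc _ hmem, ← hline, e.apply_symm_apply]
  change ψ y < ψ y - s
  linarith [mem_Iio.1 hs]

/-- Surface measure on the graph is at most (1+K)² times Lebesgue measure on the plane; Tonelli
assembles the vertical-line bounds into a volume integral. -/
theorem setLIntegral_frontier_le {Ω : Set E3} (hΩ : IsOpen Ω) {x : E3} {r : ℝ}
    {e : E3 ≃ₗᵢ[ℝ] WithLp 2 (EuclideanSpace ℝ (Fin 2) × ℝ)}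
    {ψ : EuclideanSpace ℝ (Fin 2) → ℝ} {K : ℝ≥0} (hψ : LipschitzWith K ψ)
    (hc : ∀ y ∈ Metric.ball x r, y ∈ Ω ↔ ψ (e y).fst < (e y).snd)
    {g : E3 → ℝ} (hg : ContDiff ℝ 1 g) (hgc : HasCompactSupport g)
    (hgs : tsupport g ⊆ Metric.ball x r) :
    ∫⁻ y, ‖g y‖ₑ ∂(surfaceMeasure Ω) ≤ ((1 + K) ^ 2 : ℝ≥0) *
      ∫⁻ x in Ω, ‖fderiv ℝ g x (e.symm (WithLp.toLp 2 (0, 1)))‖ₑ := by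
  have hgm : Measurable fun y => ‖g y‖ₑ := hg.continuous.measurable.enorm
  have hQ : Measurable (Ω.indicator
      (fun x => ‖fderiv ℝ g x (e.symm (WithLp.toLp 2 (0, 1)))‖ₑ)) :=
    (((hg.continuous_fderiv one_ne_zero).clm_apply continuous_const).measurable.enorm).indicator
      hΩ.measurableSet
  have h0 : ∀ y ∉ Metric.ball x r, ‖g y‖ₑ = 0 := fun y hy => by
    rw [image_eq_zero_of_notMem_tsupport fun h => hy (hgs h), enorm_zero]
  calc ∫⁻ y, ‖g y‖ₑ ∂(surfaceMeasure Ω)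
      = ∫⁻ y in Metric.ball x r, ‖g y‖ₑ ∂(surfaceMeasure Ω) := by
        rw [← lintegral_indicator Metric.isOpen_ball.measurableSet]
        congr 1
        exact (indicator_eq_self.2 fun y hy => by
          by_contra h; exact hy (h0 y h)).symm
    _ ≤ ∫⁻ y in range (graphMap e ψ), ‖g y‖ₑ ∂(Measure.euclideanHausdorffMeasure 2) := by
        rw [surfaceMeasure, Measure.restrict_restrict Metric.isOpen_ball.measurableSet, inter_comm]
        exact lintegral_mono_set (frontier_inter_ball_subset hΩ hψ.continuous hc)
    _ ≤ ∫⁻ y, ‖g y‖ₑ ∂(((1 + K) ^ 2 : ℝ≥0) • volume.map (graphMap e ψ)) :=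
        lintegral_mono' (restrict_range_graphMap_le e hψ) le_rfl
    _ = ((1 + K) ^ 2 : ℝ≥0) * ∫⁻ y, ‖g (graphMap e ψ y)‖ₑ := by
        rw [lintegral_smul_measure, lintegral_map hgm
          (lipschitzWith_graphMap e hψ).continuous.measurable]
        rfl
    _ ≤ _ := by
        gcongr
        rw [← lintegral_indicator hΩ.measurableSet, ← lintegral_comp_chart e hQ]
        exact lintegral_mono (enorm_graphMap_le hc hg hgc hgs)

theorem norm_fderiv_apply_le (φ : E3 → ℂ) (x n : E3) :
    ‖fderiv ℝ φ x n‖ ≤ ‖n‖ * ‖classicalGrad φ x‖ := by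
  have h : fderiv ℝ φ x n = inner ℂ (WithLp.toLp 2 fun i => ((n i : ℝ) : ℂ) : C3)
      (classicalGrad φ x) := by
    have hn : n = ∑ i, n i • EuclideanSpace.single i (1 : ℝ) := by
      ext j; simp [Finset.sum_apply, Pi.single_apply]
    conv_lhs => rw [hn]
    simp [PiLp.inner_apply, classicalGrad, partialDeriv, mul_comm]
  rw [h]
  refine (norm_inner_le_norm _ _).trans (le_of_eq ?_)
  congr 1
  simp [EuclideanSpace.norm_eq]

/-- The previous bound is applied to χ|φ|²: its vertical derivative is at most M|φ|² + 2|φ||∇φ|,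
where M bounds the derivative of the bump χ. This gives the product form of the estimate. -/
theorem exists_local_trace_bound {Ω : Set E3} (hΩ : IsBoundedLipschitzDomain Ω) {x : E3}
    (hx : x ∈ frontier Ω) : ∃ s ∈ 𝓝 x, ∃ C : ℝ≥0, ∀ φ : E3 → ℂ, ContDiff ℝ ∞ φ →
      HasCompactSupport φ → ∫⁻ y in s, ‖φ y‖ₑ ^ 2 ∂(surfaceMeasure Ω) ≤
        C * ∫⁻ x in Ω, (‖φ x‖ₑ ^ 2 + ‖φ x‖ₑ * ‖classicalGrad φ x‖ₑ) := by
  obtain ⟨r, e, ψ, K, hr, hψ, hc⟩ := hΩ.exists_chart x hx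
  set n : E3 := e.symm (WithLp.toLp 2 (0, 1)) with hn
  have hn1 : ‖n‖ = 1 := by
    rw [hn, e.symm.norm_map, WithLp.prod_norm_eq_of_L2]; simp
  let χ : ContDiffBump x := ⟨r / 4, r / 2, by positivity, by linarith⟩
  have hχ : ContDiff ℝ ∞ χ := χ.contDiff
  obtain ⟨M, hM⟩ := (χ.hasCompactSupport.fderiv (𝕜 := ℝ)).exists_bound_of_continuous
    (hχ.continuous_fderiv (by simp))
  have hM0 : 0 ≤ M := (norm_nonneg _).trans (hM x)
  refine ⟨Metric.ball x (r / 4), Metric.ball_mem_nhds x (by positivity),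
    (1 + K) ^ 2 * (Real.toNNReal M + 2), fun φ hφ hφc => ?_⟩
  set g : E3 → ℝ := fun y => χ y * ‖φ y‖ ^ 2 with hg
  have hgd : ContDiff ℝ 1 g := (hχ.mul (hφ.norm_sq ℝ)).of_le (by norm_cast)
  have hgc : HasCompactSupport g := χ.hasCompactSupport.mul_right
  have hgs : tsupport g ⊆ Metric.ball x r := by
    refine (tsupport_mul_subset_left).trans ?_
    rw [χ.tsupport_eq]
    exact Metric.closedBall_subset_ball (by simp [χ]; linarith)
  have hder : ∀ y, ‖fderiv ℝ g y n‖ₑ ≤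
      (Real.toNNReal M + 2 : ℝ≥0) * (‖φ y‖ₑ ^ 2 + ‖φ y‖ₑ * ‖classicalGrad φ y‖ₑ) := fun y => by
    have d1 : HasFDerivAt χ (fderiv ℝ χ y) y :=
      (hχ.differentiable (by simp)).differentiableAt.hasFDerivAt
    have d2 : HasFDerivAt φ (fderiv ℝ φ y) y :=
      (hφ.differentiable (by simp)).differentiableAt.hasFDerivAt
    have h1 : ‖fderiv ℝ g y n‖ ≤
        (M + 2) * (‖φ y‖ ^ 2 + ‖φ y‖ * ‖classicalGrad φ y‖) := by
      rw [show g = ⇑χ * fun y => ‖φ y‖ ^ 2 from rfl, (d1.mul d2.norm_sq).fderiv]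
      have b1 : ‖fderiv ℝ χ y n‖ ≤ M := by
        refine ((fderiv ℝ χ y).le_opNorm n).trans ?_
        rw [hn1, mul_one]; exact hM y
      have b2 := norm_fderiv_apply_le φ y n
      rw [hn1, one_mul] at b2
      have b3 : ‖χ y‖ ≤ 1 := by
        rw [Real.norm_of_nonneg χ.nonneg]; exact χ.le_one
      have b4 : ‖inner ℝ (φ y) (fderiv ℝ φ y n)‖ ≤ ‖φ y‖ * ‖classicalGrad φ y‖ :=
        (norm_inner_le_norm _ _).trans (by gcongr)
      calc _ = ‖χ y * (2 * inner ℝ (φ y) (fderiv ℝ φ y n)) + ‖φ y‖ ^ 2 * fderiv ℝ χ y n‖ := by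
            simp [two_smul, two_mul]; ring_nf
        _ ≤ 1 * (2 * (‖φ y‖ * ‖classicalGrad φ y‖)) + ‖φ y‖ ^ 2 * M := by
            refine (norm_add_le _ _).trans ?_
            rw [norm_mul, norm_mul, norm_mul, norm_pow, norm_norm, Real.norm_ofNat]
            gcongr
        _ ≤ _ := by
            have : 0 ≤ M * (‖φ y‖ * ‖classicalGrad φ y‖) := by positivity
            nlinarith [sq_nonneg ‖φ y‖]
    have h2 : ‖fderiv ℝ g y n‖₊ ≤ (Real.toNNReal M + 2 : ℝ≥0) *
        (‖φ y‖₊ ^ 2 + ‖φ y‖₊ * ‖classicalGrad φ y‖₊) := by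
      rw [← NNReal.coe_le_coe]
      push_cast
      rw [Real.coe_toNNReal M hM0]
      exact h1
    simp only [enorm_eq_nnnorm]
    exact_mod_cast h2
  calc ∫⁻ y in Metric.ball x (r / 4), ‖φ y‖ₑ ^ 2 ∂(surfaceMeasure Ω)
      ≤ ∫⁻ y in Metric.ball x (r / 4), ‖g y‖ₑ ∂(surfaceMeasure Ω) := by
        refine setLIntegral_mono hgd.continuous.measurable.enorm fun y hy => ?_
        rw [hg]
        simp only
        rw [χ.one_of_mem_closedBall (Metric.ball_subset_closedBall hy), one_mul, enorm_pow,
          enorm_norm]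
    _ ≤ ∫⁻ y, ‖g y‖ₑ ∂(surfaceMeasure Ω) := setLIntegral_le_lintegral _ _
    _ ≤ ((1 + K) ^ 2 : ℝ≥0) * ∫⁻ x in Ω, ‖fderiv ℝ g x n‖ₑ :=
        setLIntegral_frontier_le hΩ.isOpen hψ hc hgd hgc hgs
    _ ≤ ((1 + K) ^ 2 : ℝ≥0) * ∫⁻ x in Ω, (Real.toNNReal M + 2 : ℝ≥0) *
          (‖φ x‖ₑ ^ 2 + ‖φ x‖ₑ * ‖classicalGrad φ x‖ₑ) := by
        gcongr with y
        exact hder y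
    _ = _ := by
        rw [lintegral_const_mul' _ _ ENNReal.coe_ne_top, ← mul_assoc, ENNReal.coe_mul]

/-- Local bounds add up over a finite cover of the compact boundary. -/
theorem exists_lintegral_trace_bound {Ω : Set E3} (hΩ : IsBoundedLipschitzDomain Ω) :
    ∃ C : ℝ≥0, ∀ φ : E3 → ℂ, ContDiff ℝ ∞ φ → HasCompactSupport φ →
      ∫⁻ y, ‖φ y‖ₑ ^ 2 ∂(surfaceMeasure Ω) ≤
        C * ∫⁻ x in Ω, (‖φ x‖ₑ ^ 2 + ‖φ x‖ₑ * ‖classicalGrad φ x‖ₑ) := by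
  have hcomp : IsCompact (frontier Ω) :=
    hΩ.isBounded.isCompact_closure.of_isClosed_subset isClosed_frontier frontier_subset_closure
  have key := hcomp.induction_on
    (p := fun s => ∃ C : ℝ≥0, ∀ φ : E3 → ℂ, ContDiff ℝ ∞ φ →
      HasCompactSupport φ → ∫⁻ y in s, ‖φ y‖ₑ ^ 2 ∂(surfaceMeasure Ω) ≤
        C * ∫⁻ x in Ω, (‖φ x‖ₑ ^ 2 + ‖φ x‖ₑ * ‖classicalGrad φ x‖ₑ))
    ⟨0, by simp⟩
    (fun s t hst ⟨C, hC⟩ => ⟨C, fun φ h1 h2 => (lintegral_mono_set hst).trans (hC φ h1 h2)⟩)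
    (fun s t ⟨C, hC⟩ ⟨D, hD⟩ => ⟨C + D, fun φ h1 h2 => by
      rw [ENNReal.coe_add, add_mul]
      exact (lintegral_union_le _ s t).trans (add_le_add (hC φ h1 h2) (hD φ h1 h2))⟩)
    (fun x hx => by
      obtain ⟨s, hs, h⟩ := exists_local_trace_bound hΩ hx
      exact ⟨s, mem_nhdsWithin_of_mem_nhds hs, h⟩)
  obtain ⟨C, hC⟩ := key
  refine ⟨C, fun φ h1 h2 => ?_⟩
  have := hC φ h1 h2
  rwa [surfaceMeasure, Measure.restrict_restrict isClosed_frontier.measurableSet, inter_self]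
    at this

theorem eLpNorm_two_sq {α F : Type*} [MeasurableSpace α] {μ : Measure α} [NormedAddCommGroup F]
    (f : α → F) : eLpNorm f 2 μ ^ 2 = ∫⁻ x, ‖f x‖ₑ ^ 2 ∂μ := by
  have h := eLpNorm_nnreal_pow_eq_lintegral (f := f) (μ := μ) (p := 2) two_ne_zero
  rw [← ENNReal.rpow_natCast]
  simp_rw [← ENNReal.rpow_natCast]
  exact h

theorem lintegral_mul_le_eLpNorm_two {α F F' : Type*} [MeasurableSpace α] {μ : Measure α}
    [NormedAddCommGroup F] [NormedAddCommGroup F'] {f : α → F} {g : α → F'}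
    (hf : AEStronglyMeasurable f μ) (hg : AEStronglyMeasurable g μ) :
    ∫⁻ x, ‖f x‖ₑ * ‖g x‖ₑ ∂μ ≤ eLpNorm f 2 μ * eLpNorm g 2 μ := by
  have h := ENNReal.lintegral_mul_le_Lp_mul_Lq μ Real.HolderConjugate.two_two hf.enorm hg.enorm
  simpa [eLpNorm_eq_lintegral_rpow_enorm_toReal (p := 2) two_ne_zero ENNReal.ofNat_ne_top] using h

theorem memLp_classicalGrad_of_contDiff {Ω : Set E3} {φ : E3 → ℂ} (h1 : ContDiff ℝ ∞ φ)
    (h2 : HasCompactSupport φ) : MemLp (classicalGrad φ) 2 (volume.restrict Ω) :=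
  MemLp.of_eval_piLp fun i => (partialDeriv_continuous h1 i).memLp_of_hasCompactSupport
    (partialDeriv_hasCompactSupport h2 i)

theorem exists_eLpNorm_trace_bound {Ω : Set E3} (hΩ : IsBoundedLipschitzDomain Ω) :
    ∃ C : ℝ≥0, ∀ φ : E3 → ℂ, ContDiff ℝ ∞ φ → HasCompactSupport φ →
      eLpNorm φ 2 (surfaceMeasure Ω) ^ 2 ≤ C * (eLpNorm φ 2 (volume.restrict Ω) ^ 2 +
        eLpNorm φ 2 (volume.restrict Ω) * eLpNorm (classicalGrad φ) 2 (volume.restrict Ω)) := by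
  obtain ⟨C, hC⟩ := exists_lintegral_trace_bound hΩ
  refine ⟨C, fun φ h1 h2 => ?_⟩
  have hc : Continuous (classicalGrad φ) :=
    (PiLp.continuous_toLp 2 _).comp (continuous_pi fun i => partialDeriv_continuous h1 i)
  rw [eLpNorm_two_sq, eLpNorm_two_sq]
  refine (hC φ h1 h2).trans ?_
  rw [lintegral_add_left (h1.continuous.measurable.enorm.pow_const 2)]
  gcongr
  exact lintegral_mul_le_eLpNorm_two h1.continuous.aestronglyMeasurable hc.aestronglyMeasurable

/-- The right side of the trace bound is finite, so the boundary condition in `SmoothFun` is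
automatic and mollified functions qualify. -/
theorem memLp_surfaceMeasure {Ω : Set E3} (hΩ : IsBoundedLipschitzDomain Ω) {φ : E3 → ℂ}
    (h1 : ContDiff ℝ ∞ φ) (h2 : HasCompactSupport φ) : MemLp φ 2 (surfaceMeasure Ω) := by
  obtain ⟨C, hC⟩ := exists_eLpNorm_trace_bound hΩ
  have hA : eLpNorm φ 2 (volume.restrict Ω) ≠ ⊤ :=
    (h1.continuous.memLp_of_hasCompactSupport h2).eLpNorm_ne_top
  have hB : eLpNorm (classicalGrad φ) 2 (volume.restrict Ω) ≠ ⊤ :=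
    (memLp_classicalGrad_of_contDiff h1 h2).eLpNorm_ne_top
  have h : eLpNorm φ 2 (surfaceMeasure Ω) ^ 2 < ⊤ := (hC φ h1 h2).trans_lt (by finiteness)
  exact ⟨h1.continuous.aestronglyMeasurable, (ENNReal.pow_lt_top_iff.1 h).resolve_right two_ne_zero⟩

theorem exists_trace_bound {Ω : Set E3} (hΩ : IsBoundedLipschitzDomain Ω) :
    ∃ C : ℝ, 0 < C ∧ ∀ φ : SmoothFun Ω, ‖smoothToBdry Ω φ‖ ^ 2 ≤
      C * (‖val Ω (smoothToH1 Ω φ)‖ ^ 2 +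
        ‖val Ω (smoothToH1 Ω φ)‖ * ‖grad Ω (smoothToH1 Ω φ)‖) := by
  obtain ⟨C, hC⟩ := exists_eLpNorm_trace_bound hΩ
  refine ⟨C + 1, by positivity, fun φ => ?_⟩
  have hA := (memLp_smooth φ).eLpNorm_ne_top
  have hB := (memLp_classicalGrad φ).eLpNorm_ne_top
  have t1 : smoothToBdry Ω φ = φ.2.2.2.toLp φ := rfl
  have t2 : val Ω (smoothToH1 Ω φ) = (memLp_smooth φ).toLp φ := rfl
  have t3 : grad Ω (smoothToH1 Ω φ) = (memLp_classicalGrad φ).toLp _ := rfl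
  rw [t1, t2, t3, Lp.norm_toLp, Lp.norm_toLp, Lp.norm_toLp]
  have h := ENNReal.toReal_mono (by finiteness) (hC φ φ.2.1 φ.2.2.1)
  rw [ENNReal.toReal_pow, ENNReal.toReal_mul, ENNReal.toReal_add (by finiteness) (by finiteness),
    ENNReal.toReal_pow, ENNReal.toReal_mul, ENNReal.coe_toReal] at h
  refine h.trans ?_
  gcongr
  linarith

/-! ### Mollification in L². -/

theorem exists_eLpNorm_translate_sub_le {F : Type*} [NormedAddCommGroup F] {f : E3 → F}
    (hf : MemLp f 2 volume) {ε : ℝ≥0∞} (hε : ε ≠ 0) :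
    ∃ δ > 0, ∀ z : E3, ‖z‖ ≤ δ → eLpNorm (fun y => f (y - z) - f y) 2 volume ≤ ε := by
  have : Fact ((2 : ℝ≥0∞) ≠ ⊤) := ⟨ENNReal.ofNat_ne_top⟩
  have hc : Continuous fun c : E3 => (DomAddAct.mk c) +ᵥ hf.toLp f :=
    DomAddAct.continuous_mk.vadd continuous_const
  have ht : Tendsto (fun c : E3 => edist (DomAddAct.mk c +ᵥ hf.toLp f) (hf.toLp f)) (𝓝 0) (𝓝 0) := by
    have := (hc.tendsto 0).edist (tendsto_const_nhds (x := hf.toLp f))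
    simpa using this
  obtain ⟨δ, hδ, h⟩ := Metric.eventually_nhds_iff.1
    (ht.eventually (ge_mem_nhds (pos_iff_ne_zero.2 hε)))
  refine ⟨δ / 2, by positivity, fun z hz => ?_⟩
  have h' := h (y := -z) (by rw [dist_zero_right, norm_neg]; linarith)
  rw [DomAddAct.mk_vadd_toLp, Lp.edist_toLp_toLp] at h'
  refine le_trans (le_of_eq ?_) h'
  congr 1
  ext y
  simp [sub_eq_neg_add]

theorem enorm_integral_sq_le {α F : Type*} [MeasurableSpace α] {P : Measure α}
    [IsProbabilityMeasure P] [NormedAddCommGroup F] [NormedSpace ℝ F] {D : α → F}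
    (hD : AEStronglyMeasurable D P) : ‖∫ x, D x ∂P‖ₑ ^ 2 ≤ ∫⁻ x, ‖D x‖ₑ ^ 2 ∂P := by
  rw [← eLpNorm_two_sq]
  gcongr
  refine (enorm_integral_le_lintegral_enorm _).trans ?_
  rw [← eLpNorm_one_eq_lintegral_enorm]
  exact eLpNorm_le_eLpNorm_of_exponent_le one_le_two hD

/-- Under the probability measure with density η, the error is the average of f(y−z) − f(y). Jensen
and Tonelli bound it by the largest translation error over the support. The kernel need not be
centred at 0. -/
theorem eLpNorm_mollify_sub_le {F : Type*} [NormedAddCommGroup F] [NormedSpace ℝ F]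
    [CompleteSpace F] {f : E3 → F} (hf : MemLp f 2 volume) (hfm : StronglyMeasurable f)
    {η : E3 → ℝ} (h1 : Continuous η) (h2 : HasCompactSupport η) (h3 : ∀ z, 0 ≤ η z)
    (h4 : ∫ z, η z = 1) {δ : ℝ} (h5 : ∀ z, η z ≠ 0 → ‖z‖ ≤ δ) {ε : ℝ≥0∞}
    (h : ∀ z : E3, ‖z‖ ≤ δ → eLpNorm (fun y => f (y - z) - f y) 2 volume ≤ ε) :
    eLpNorm (fun y => (∫ z, η (y - z) • f z) - f y) 2 volume ≤ ε := by
  have hηm : Measurable fun z => Real.toNNReal (η z) := h1.measurable.real_toNNReal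
  set P : Measure E3 := volume.withDensity fun z => (Real.toNNReal (η z) : ℝ≥0∞) with hP
  have hPp : IsProbabilityMeasure P := by
    refine ⟨?_⟩
    rw [hP, withDensity_apply _ MeasurableSet.univ, setLIntegral_univ]
    change ∫⁻ z, ENNReal.ofReal (η z) = 1
    rw [← ofReal_integral_eq_lintegral_ofReal (h1.integrable_of_hasCompactSupport h2)
      (Eventually.of_forall h3), h4, ENNReal.ofReal_one]
  have hPi : ∀ g : E3 → F, ∫ z, g z ∂P = ∫ z, η z • g z := fun g => by
    rw [hP, integral_withDensity_eq_integral_smul hηm]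
    refine integral_congr_ae (Eventually.of_forall fun z => ?_)
    simp only [NNReal.smul_def, Real.coe_toNNReal _ (h3 z)]
  have hint : ∀ y, Integrable (fun z => f (y - z)) P := fun y => by
    rw [hP, integrable_withDensity_iff_integrable_smul hηm]
    have hfy : MemLp (fun z => f (y - z)) 2 volume :=
      hf.comp_measurePreserving (Measure.measurePreserving_sub_left volume y)
    refine (memLp_one_iff_integrable.1
      (hfy.smul (h1.memLp_of_hasCompactSupport h2 (p := 2)))).congr
      (Eventually.of_forall fun z => ?_)
    simp [NNReal.smul_def, Real.coe_toNNReal _ (h3 z)]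
  have hrep : ∀ y, (∫ z, η (y - z) • f z) - f y = ∫ z, (f (y - z) - f y) ∂P := fun y => by
    rw [integral_sub (hint y) (integrable_const _), integral_const, hPi,
      ← integral_sub_left_eq_self (fun z => η (y - z) • f z) volume y]
    simp
  have hm : StronglyMeasurable fun p : E3 × E3 => f (p.1 - p.2) - f p.1 :=
    (hfm.comp_measurable (measurable_fst.sub measurable_snd)).sub
      (hfm.comp_measurable measurable_fst)
  have hsq : eLpNorm (fun y => (∫ z, η (y - z) • f z) - f y) 2 volume ^ 2 ≤ ε ^ 2 := by
    rw [eLpNorm_two_sq]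
    calc ∫⁻ y, ‖(∫ z, η (y - z) • f z) - f y‖ₑ ^ 2
        ≤ ∫⁻ y, ∫⁻ z, ‖f (y - z) - f y‖ₑ ^ 2 ∂P := by
          refine lintegral_mono fun y => ?_
          rw [hrep]
          exact enorm_integral_sq_le (hm.comp_measurable measurable_prodMk_left).aestronglyMeasurable
      _ = ∫⁻ z, (∫⁻ y, ‖f (y - z) - f y‖ₑ ^ 2) ∂P := by
          exact lintegral_lintegral_swap (f := fun y z => ‖f (y - z) - f y‖ₑ ^ 2)
            (hm.enorm.pow_const 2).aemeasurable
      _ ≤ ∫⁻ z, ε ^ 2 ∂P := by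
          have hPz : ∀ᵐ z ∂P, η z ≠ 0 := by
            rw [hP, ae_withDensity_iff hηm.coe_nnreal_ennreal]
            refine Eventually.of_forall fun z hz h0 => hz ?_
            simp [h0]
          refine lintegral_mono_ae (hPz.mono fun z hz => ?_)
          rw [← eLpNorm_two_sq]
          gcongr
          exact h z (h5 z hz)
      _ = ε ^ 2 := by simp
  exact (ENNReal.pow_le_pow_left_iff two_ne_zero).1 hsq

/-! ### Smooth approximation up to the boundary. -/

theorem exists_cone_subset {Ω : Set E3} (hΩ : IsBoundedLipschitzDomain Ω) {x : E3}
    (hx : x ∈ closure Ω) : ∃ r > 0, ∃ n : E3, ∃ c > 0, ∃ t₀ > 0, ∀ t, 0 < t → t ≤ t₀ →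
      ∀ y ∈ Ω, y ∈ Metric.ball x r → Metric.closedBall (y + t • n) (c * t) ⊆ Ω := by
  by_cases hxΩ : x ∈ Ω
  · obtain ⟨r, hr, h⟩ := Metric.isOpen_iff.1 hΩ.isOpen x hxΩ
    refine ⟨r / 2, by positivity, 0, 1, one_pos, r / 4, by positivity, fun t _ ht y _ hy z hz => ?_⟩
    rw [smul_zero, add_zero, one_mul, Metric.mem_closedBall] at hz
    refine h ?_
    rw [Metric.mem_ball] at hy ⊢
    linarith [dist_triangle z y x]
  · have hxf : x ∈ frontier Ω := by rw [hΩ.isOpen.frontier_eq]; exact ⟨hx, hxΩ⟩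
    obtain ⟨r, e, ψ, K, hr, hψ, hc⟩ := hΩ.exists_chart x hxf
    set n : E3 := e.symm (WithLp.toLp 2 (0, 1)) with hn
    have hn1 : ‖n‖ = 1 := by
      rw [hn, e.symm.norm_map, WithLp.prod_norm_eq_of_L2]; simp
    have hK : 0 ≤ (K : ℝ) := K.2
    have hK1 : 0 < 1 + (K : ℝ) := by linarith
    -- Moving by tn raises the height above the graph by t, while a perturbation of size ct changes
    -- it by at most (1+K)ct = t/2. The radii r/2 and r/8 keep everything inside the chart.
    refine ⟨r / 2, by positivity, n, 1 / (2 * (1 + K)), by positivity, r / 8, by positivity,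
      fun t ht0 ht y hyΩ hy z hz => ?_⟩
    set c : ℝ := 1 / (2 * (1 + K)) with hcdef
    have hc0 : 0 < c := by positivity
    have hc1 : c * (1 + K) = 1 / 2 := by rw [hcdef]; field_simp
    have hcle : c ≤ 1 := by nlinarith
    rw [Metric.mem_closedBall, dist_eq_norm] at hz
    rw [Metric.mem_ball] at hy
    have hzy : dist z y < r / 2 := by
      have : z - y = (z - (y + t • n)) + t • n := by abel
      rw [dist_eq_norm, this]
      have h1 := norm_add_le (z - (y + t • n)) (t • n)
      rw [norm_smul, hn1, Real.norm_of_nonneg ht0.le, mul_one] at h1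
      nlinarith
    have hzx : z ∈ Metric.ball x r := by
      rw [Metric.mem_ball]; linarith [dist_triangle z y x]
    have hyx : y ∈ Metric.ball x r := by rw [Metric.mem_ball]; linarith
    have hy' := (hc y hyx).1 hyΩ
    rw [hc z hzx]
    set w : WithLp 2 (EuclideanSpace ℝ (Fin 2) × ℝ) := e (z - (y + t • n)) with hw
    have hez : e z = e y + t • WithLp.toLp 2 (0, 1) + w := by
      rw [hw, map_sub, map_add, map_smul, hn, e.apply_symm_apply]; abel
    have hwn : ‖w‖ ≤ c * t := by rw [hw, e.norm_map]; exact hz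
    have hw1 : ‖w.fst‖ ≤ c * t := (WithLp.norm_fst_le _ w).trans hwn
    have hw2 : ‖w.snd‖ ≤ c * t := (WithLp.norm_snd_le _ w).trans hwn
    have e1 : (e z).fst = (e y).fst + w.fst := by rw [hez]; simp
    have e2 : (e z).snd = (e y).snd + t + w.snd := by rw [hez]; simp
    have hψ' := hψ.dist_le_mul ((e y).fst + w.fst) (e y).fst
    rw [dist_self_add_left, Real.dist_eq] at hψ'
    have hψ'' := (le_abs_self _).trans hψ'
    rw [e1, e2]
    have := neg_le_of_abs_le hw2
    have h3 : (K : ℝ) * ‖w.fst‖ ≤ K * (c * t) := by gcongr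
    have h4 : K * (c * t) + c * t = t / 2 := by linear_combination t * hc1
    linarith

/-- The gradient of the product `χ u`, where `G` is the gradient of `u`. -/
noncomputable def cutoffGrad (χ : E3 → ℝ) (u : E3 → ℂ) (G : E3 → C3) (x : E3) : C3 :=
  χ x • G x + WithLp.toLp 2 fun i => partialDeriv i χ x • u x

theorem memLp_smul_of_continuous {F : Type*} [NormedAddCommGroup F] [NormedSpace ℝ F]
    {μ : Measure E3} [IsFiniteMeasureOnCompacts μ] {χ : E3 → ℝ} (h1 : Continuous χ)
    (h2 : HasCompactSupport χ) {u : E3 → F}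
    (hu : MemLp u 2 μ) : MemLp (fun x => χ x • u x) 2 μ :=
  hu.smul (h1.memLp_of_hasCompactSupport h2 (p := ⊤))

theorem memLp_cutoffGrad {Ω : Set E3} {χ : E3 → ℝ} (h1 : ContDiff ℝ ∞ χ)
    (h2 : HasCompactSupport χ) {u : E3 → ℂ} {G : E3 → C3} (hu : MemLp u 2 (volume.restrict Ω))
    (hG : MemLp G 2 (volume.restrict Ω)) : MemLp (cutoffGrad χ u G) 2 (volume.restrict Ω) :=
  (memLp_smul_of_continuous h1.continuous h2 hG).add <| MemLp.of_eval_piLp fun i =>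
    memLp_smul_of_continuous (partialDeriv_continuous h1 i) (partialDeriv_hasCompactSupport h2 i) hu

theorem partialDeriv_integral_smul {F : Type*} [NormedAddCommGroup F] [NormedSpace ℝ F]
    {η : E3 → ℝ} (h1 : ContDiff ℝ ∞ η) (h2 : HasCompactSupport η) {f : E3 → F}
    (hf : LocallyIntegrable f volume) (i : Fin 3) (y : E3) :
    partialDeriv i (fun y => ∫ z, η (y - z) • f z) y = ∫ z, partialDeriv i η (y - z) • f z := by
  have h := (h2.hasFDerivAt_convolution_right (ContinuousLinearMap.lsmul ℝ ℝ).flip hf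
    (h1.of_le (by norm_cast)) y).fderiv
  have h' := congrArg (fun A : E3 →L[ℝ] F => A (EuclideanSpace.single i 1)) h
  rw [convolution_precompR_apply _ hf (h2.fderiv (𝕜 := ℝ)) (h1.continuous_fderiv (by simp))] at h'
  exact h'

theorem contDiff_integral_smul {F : Type*} [NormedAddCommGroup F] [NormedSpace ℝ F]
    [CompleteSpace F] {η : E3 → ℝ} (h1 : ContDiff ℝ ∞ η) (h2 : HasCompactSupport η) {f : E3 → F}
    (hf : LocallyIntegrable f volume) : ContDiff ℝ ∞ (fun y => ∫ z, η (y - z) • f z) :=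
  h2.contDiff_convolution_right (ContinuousLinearMap.lsmul ℝ ℝ).flip hf h1

theorem hasCompactSupport_integral_smul {F : Type*} [NormedAddCommGroup F] [NormedSpace ℝ F]
    {η : E3 → ℝ} (h2 : HasCompactSupport η) {f : E3 → F}
    (hf : HasCompactSupport f) : HasCompactSupport (fun y => ∫ z, η (y - z) • f z) :=
  HasCompactSupport.convolution (ContinuousLinearMap.lsmul ℝ ℝ).flip hf h2

theorem integral_smul_apply {f : E3 → C3} {ψ : E3 → ℝ} (hf : Integrable fun z => ψ z • f z)
    (i : Fin 3) : (∫ z, ψ z • f z) i = ∫ z, ψ z • f z i :=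
  ((EuclideanSpace.proj i : C3 →L[ℂ] ℂ).integral_comp_comm hf).symm

theorem partialDeriv_mul_comp_sub {χ η : E3 → ℝ} (hχ : ContDiff ℝ ∞ χ) (hη : ContDiff ℝ ∞ η)
    (y z : E3) (i : Fin 3) : partialDeriv i (fun z => χ z * η (y - z)) z
      = partialDeriv i χ z * η (y - z) - χ z * partialDeriv i η (y - z) := by
  have d1 : HasFDerivAt χ (fderiv ℝ χ z) z :=
    (hχ.differentiable (by simp)).differentiableAt.hasFDerivAt
  have d2 : HasFDerivAt (fun z => η (y - z)) (-(fderiv ℝ η (y - z))) z := by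
    have d : HasFDerivAt η (fderiv ℝ η (y - z)) (y - z) :=
      (hη.differentiable (by simp)).differentiableAt.hasFDerivAt
    have := d.comp z ((hasFDerivAt_id z).const_sub y)
    simpa using! this
  have h : fderiv ℝ (fun z => χ z * η (y - z)) z = _ := (d1.mul d2).fderiv
  rw [partialDeriv, h]
  simp [partialDeriv]
  ring

/-- The weak gradient is tested against z ↦ χ(z) η(y−z), and the product-rule term in ∂χ is absorbed
into `cutoffGrad`. -/
theorem integral_partialDeriv_smul_cutoff {Ω : Set E3} {u : E3 → ℂ} {G : E3 → C3}
    (hu : MemLp u 2 (volume.restrict Ω)) (hG : MemLp G 2 (volume.restrict Ω))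
    (hw : IsWeakGradient Ω u G) {χ η : E3 → ℝ} (hχ : ContDiff ℝ ∞ χ) (hχc : HasCompactSupport χ)
    (hη : ContDiff ℝ ∞ η) {y : E3}
    (hs : tsupport (fun z => χ z * η (y - z)) ⊆ Ω) (i : Fin 3) :
    ∫ z in Ω, partialDeriv i η (y - z) • χ z • u z
      = ∫ z in Ω, η (y - z) • cutoffGrad χ u G z i := by
  have hηy : ContDiff ℝ ∞ fun z => η (y - z) := hη.comp (by fun_prop)
  have h := hw (fun z => χ z * η (y - z)) (hχ.mul hηy) hχc.mul_right hs i
  have i1 : Integrable (fun z => (partialDeriv i χ z * η (y - z)) • u z) (volume.restrict Ω) :=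
    integrable_smul_of_memLp ((partialDeriv_continuous hχ i).mul hηy.continuous)
      (partialDeriv_hasCompactSupport hχc i).mul_right hu
  have i2 : Integrable (fun z => (χ z * partialDeriv i η (y - z)) • u z) (volume.restrict Ω) :=
    integrable_smul_of_memLp (hχ.continuous.mul
      ((partialDeriv_continuous hη i).comp (by fun_prop))) hχc.mul_right hu
  have i3 : Integrable (fun z => (χ z * η (y - z)) • G z i) (volume.restrict Ω) :=
    integrable_smul_of_memLp (hχ.mul hηy).continuous hχc.mul_right (memLp_coord hG i)
  simp only [partialDeriv_mul_comp_sub hχ hη, sub_smul] at h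
  rw [integral_sub i1 i2] at h
  have e1 : ∫ z in Ω, partialDeriv i η (y - z) • χ z • u z
      = ∫ z in Ω, (χ z * partialDeriv i η (y - z)) • u z := by
    simp only [smul_smul, mul_comm]
  have e2 : ∫ z in Ω, η (y - z) • cutoffGrad χ u G z i
      = (∫ z in Ω, (χ z * η (y - z)) • G z i) +
        ∫ z in Ω, (partialDeriv i χ z * η (y - z)) • u z := by
    rw [← integral_add i3 i1]
    refine integral_congr_ae (Eventually.of_forall fun z => ?_)
    simp [cutoffGrad]
    ring
  rw [e1, e2]
  linear_combination -h

/-- The zero extension of χu may jump across Γ. A kernel supported near −tn averages, for y in Ω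
near x, only over a ball about y + tn inside Ω, so the jump is never seen. -/
theorem exists_smooth_approx_cutoff {Ω : Set E3} (hΩ : IsBoundedLipschitzDomain Ω) {x : E3}
    (hx : x ∈ closure Ω) : ∃ s : Set E3, IsOpen s ∧ x ∈ s ∧ ∀ χ : E3 → ℝ, ContDiff ℝ ∞ χ →
      HasCompactSupport χ → tsupport χ ⊆ s → ∀ (u : L2 Ω) (G : L2Vec Ω), IsWeakGradient Ω u G →
      ∀ ε : ℝ≥0∞, ε ≠ 0 → ∃ φ : E3 → ℂ, ContDiff ℝ ∞ φ ∧ HasCompactSupport φ ∧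
        eLpNorm (fun y => φ y - χ y • u y) 2 (volume.restrict Ω) ≤ ε ∧
        eLpNorm (fun y => classicalGrad φ y - cutoffGrad χ u G y) 2 (volume.restrict Ω) ≤ ε := by
  obtain ⟨r, hr, n, c, hc, t₀, ht₀, hcone⟩ := exists_cone_subset hΩ hx
  refine ⟨Metric.ball x (r / 2), Metric.isOpen_ball, Metric.mem_ball_self (by positivity),
    fun χ hχ hχc hχs u G hw ε hε => ?_⟩
  have hΩm := hΩ.isOpen.measurableSet
  have huL := Lp.memLp u
  have hGL := Lp.memLp G
  set f : E3 → ℂ := Ω.indicator fun z => χ z • u z with hf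
  set g : E3 → C3 := Ω.indicator (cutoffGrad χ u G) with hg
  have hfL : MemLp f 2 volume := (memLp_indicator_iff_restrict hΩm).2
    (memLp_smul_of_continuous hχ.continuous hχc huL)
  have hgL : MemLp g 2 volume := (memLp_indicator_iff_restrict hΩm).2
    (memLp_cutoffGrad hχ hχc huL hGL)
  have hum := Lp.stronglyMeasurable u
  have hGm := Lp.stronglyMeasurable G
  have hfm : StronglyMeasurable f :=
    (hχ.continuous.stronglyMeasurable.smul hum).indicator hΩm
  have hgm : StronglyMeasurable g := by
    refine StronglyMeasurable.indicator ?_ hΩm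
    refine (hχ.continuous.stronglyMeasurable.smul hGm).add ?_
    refine (PiLp.continuous_toLp 2 _).comp_stronglyMeasurable ?_
    exact (measurable_pi_lambda _ fun i => ((partialDeriv_continuous hχ i).stronglyMeasurable.smul
      hum).measurable).stronglyMeasurable
  have hfc : HasCompactSupport f := by
    refine hχc.mono fun z hz => ?_
    contrapose! hz
    simp only [Function.mem_support, not_not] at hz ⊢
    simp [hf, hz]
  obtain ⟨δ₁, hδ₁, hf'⟩ := exists_eLpNorm_translate_sub_le hfL hε
  obtain ⟨δ₂, hδ₂, hg'⟩ := exists_eLpNorm_translate_sub_le hgL hε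
  obtain ⟨t, ht, htt₀, htδ₁, htδ₂, htr⟩ : ∃ t, 0 < t ∧ t ≤ t₀ ∧ t * (‖n‖ + c) ≤ δ₁ ∧
      t * (‖n‖ + c) ≤ δ₂ ∧ t * (‖n‖ + c) < r / 2 := by
    have hnc : 0 < ‖n‖ + c := by positivity
    have ht : Tendsto (fun t : ℝ => t * (‖n‖ + c)) (𝓝[>] 0) (𝓝 0) := by
      have : Tendsto (fun t : ℝ => t * (‖n‖ + c)) (𝓝 0) (𝓝 (0 * (‖n‖ + c))) :=
        (continuous_id.mul continuous_const).tendsto 0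
      rw [zero_mul] at this
      exact this.mono_left nhdsWithin_le_nhds
    have h1 : ∀ᶠ t : ℝ in 𝓝[>] 0, 0 < t := eventually_mem_nhdsWithin
    have h2 : ∀ᶠ t : ℝ in 𝓝[>] 0, t ≤ t₀ := nhdsWithin_le_nhds (ge_mem_nhds ht₀)
    exact (h1.and (h2.and ((ht.eventually (ge_mem_nhds hδ₁)).and
      ((ht.eventually (ge_mem_nhds hδ₂)).and
        (ht.eventually (gt_mem_nhds (half_pos hr))))))).exists
  let b : ContDiffBump (-(t • n)) := ⟨c * t / 2, c * t, by positivity, half_lt_self (by positivity)⟩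
  set η : E3 → ℝ := b.normed volume with hη
  have hηs : ContDiff ℝ ∞ η := b.contDiff_normed
  have hηc : HasCompactSupport η := b.hasCompactSupport_normed
  have hη0 : ∀ z, 0 ≤ η z := b.nonneg_normed
  have hη1 : ∫ z, η z = 1 := b.integral_normed
  have hηt : tsupport η = Metric.closedBall (-(t • n)) (c * t) := b.tsupport_normed_eq
  have hηn : ∀ z ∈ tsupport η, ‖z‖ ≤ t * (‖n‖ + c) := fun z hz => by
    rw [hηt, Metric.mem_closedBall, dist_eq_norm] at hz
    have h1 : z = (z - -(t • n)) - t • n := by abel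
    have h2 := norm_sub_le (z - -(t • n)) (t • n)
    rw [← h1, norm_smul, Real.norm_of_nonneg ht.le] at h2
    linarith
  have hflI : LocallyIntegrable f volume := hfL.locallyIntegrable one_le_two
  set φ : E3 → ℂ := fun y => ∫ z, η (y - z) • f z with hφ
  -- This holds only on Ω: `g` need not be the weak gradient of `f` on the whole space. If z is in
  -- the support of χ and y − z in that of η, then y is within r of x and the cone property puts z
  -- in Ω.
  have hgrad : ∀ y ∈ Ω, classicalGrad φ y = ∫ z, η (y - z) • g z := fun y hy => by
    have hηy : MemLp (fun z => η (y - z)) 2 volume :=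
      (hηs.continuous.memLp_of_hasCompactSupport hηc).comp_measurePreserving
        (Measure.measurePreserving_sub_left volume y)
    have hs : tsupport (fun z => χ z * η (y - z)) ⊆ Ω := fun z hz => by
      have hz1 : z ∈ tsupport χ := tsupport_mul_subset_left hz
      have hz2 : y - z ∈ tsupport η :=
        tsupport_comp_subset_preimage η (f := fun z => y - z) (by fun_prop)
          (tsupport_mul_subset_right hz)
      have hzx := Metric.mem_ball.1 (hχs hz1)
      have hyz : dist y z ≤ t * (‖n‖ + c) := by rw [dist_eq_norm]; exact hηn _ hz2
      refine hcone t ht htt₀ y hy ?_ ?_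
      · rw [Metric.mem_ball]
        linarith [dist_triangle y z x]
      · rw [hηt, Metric.mem_closedBall, dist_eq_norm] at hz2
        rw [Metric.mem_closedBall, dist_comm, dist_eq_norm]
        refine le_trans (le_of_eq ?_) hz2
        congr 1
        abel
    ext i
    rw [integral_smul_apply (memLp_one_iff_integrable.1 (hgL.smul hηy))]
    change partialDeriv i φ y = _
    rw [hφ, partialDeriv_integral_smul hηs hηc hflI]
    have e1 : ∫ z, partialDeriv i η (y - z) • f z
        = ∫ z in Ω, partialDeriv i η (y - z) • χ z • u z := by
      rw [← integral_indicator hΩm]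
      congr 1
      ext z
      by_cases hz : z ∈ Ω <;> simp [hf, hz]
    have e2 : ∫ z, η (y - z) • g z i = ∫ z in Ω, η (y - z) • cutoffGrad χ u G z i := by
      rw [← integral_indicator hΩm]
      congr 1
      ext z
      by_cases hz : z ∈ Ω <;> simp [hg, hz]
    rw [e1, e2]
    exact integral_partialDeriv_smul_cutoff huL hGL hw hχ hχc hηs hs i
  refine ⟨φ, contDiff_integral_smul hηs hηc hflI, hasCompactSupport_integral_smul hηc hfc, ?_, ?_⟩
  · have h := eLpNorm_mollify_sub_le hfL hfm hηs.continuous hηc hη0 hη1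
      (fun z hz => (hηn z (subset_tsupport η hz)).trans htδ₁) hf'
    refine le_trans (le_of_eq ?_) ((eLpNorm_mono_measure _ (Measure.restrict_le_self (s := Ω))).trans h)
    refine eLpNorm_congr_ae (ae_restrict_of_forall_mem hΩm fun y hy => ?_)
    simp [hφ, hf, hy]
  · have h := eLpNorm_mollify_sub_le hgL hgm hηs.continuous hηc hη0 hη1
      (fun z hz => (hηn z (subset_tsupport η hz)).trans htδ₂) hg'
    refine le_trans (le_of_eq ?_) ((eLpNorm_mono_measure _ (Measure.restrict_le_self (s := Ω))).trans h)
    refine eLpNorm_congr_ae (ae_restrict_of_forall_mem hΩm fun y hy => ?_)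
    simp only [hgrad y hy, hg, indicator_of_mem hy]

end HelmholtzRobin

/-! ### Partition of unity and density of smooth functions. -/

open scoped Manifold in
theorem exists_finite_smooth_partition {E : Type*} [NormedAddCommGroup E] [NormedSpace ℝ E]
    [FiniteDimensional ℝ E] {K : Set E} (hK : IsCompact K) {U : E → Set E}
    (hU : ∀ x ∈ K, IsOpen (U x) ∧ x ∈ U x) :
    ∃ (t : Finset E) (χ : t → E → ℝ), (∀ i : t, (i : E) ∈ K) ∧ (∀ i, ContDiff ℝ ∞ (χ i)) ∧
      (∀ i, tsupport (χ i) ⊆ U i) ∧ ∀ x ∈ K, ∑ i, χ i x = 1 := by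
  obtain ⟨t, htK, htU⟩ := hK.elim_nhds_subcover U fun x hx => (hU x hx).1.mem_nhds (hU x hx).2
  obtain ⟨f, hf⟩ := SmoothPartitionOfUnity.exists_isSubordinate 𝓘(ℝ, E) hK.isClosed
    (fun i : t => U i) (fun i => (hU i (htK i i.2)).1) (htU.trans (by simp [iUnion_subtype]))
  refine ⟨t, fun i => f i, fun i => htK i i.2, fun i => (f i).contMDiff.contDiff, hf,
    fun x hx => ?_⟩
  rw [← f.sum_eq_one hx, finsum_eq_sum_of_fintype]

namespace HelmholtzRobin

theorem memLp_cutoff {Ω : Set E3} {χ : E3 → ℝ} (h1 : ContDiff ℝ ∞ χ)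
    (h2 : HasCompactSupport χ) (u : L2 Ω) :
    MemLp (fun x => χ x • u x) 2 (volume.restrict Ω) :=
  memLp_smul_of_continuous h1.continuous h2 (Lp.memLp u)

/-- The pair `(χ u, ∇(χ u))`. -/
noncomputable def cutoffPair {Ω : Set E3} {χ : E3 → ℝ} (h1 : ContDiff ℝ ∞ χ)
    (h2 : HasCompactSupport χ) (p : WithLp 2 (L2 Ω × L2Vec Ω)) : WithLp 2 (L2 Ω × L2Vec Ω) :=
  WithLp.toLp 2 ((memLp_cutoff h1 h2 p.fst).toLp _,
    (memLp_cutoffGrad h1 h2 (Lp.memLp p.fst) (Lp.memLp p.snd)).toLp _)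

theorem Lp_coeFn_sum {α F ι : Type*} [MeasurableSpace α] {μ : Measure α} [NormedAddCommGroup F]
    {q : ℝ≥0∞} (s : Finset ι) (f : ι → Lp F q μ) :
    ⇑(∑ i ∈ s, f i) =ᵐ[μ] fun x => ∑ i ∈ s, f i x := by
  classical
  induction s using Finset.induction_on with
  | empty => simpa using! Lp.coeFn_zero F q μ
  | insert a s ha ih =>
    rw [Finset.sum_insert ha]
    filter_upwards [Lp.coeFn_add (f a) (∑ i ∈ s, f i), ih] with x hx hx'
    rw [hx, Pi.add_apply, hx', Finset.sum_insert ha]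

theorem sum_cutoffPair {Ω : Set E3} (hΩ : IsOpen Ω) {ι : Type*} [Fintype ι] {χ : ι → E3 → ℝ}
    (h1 : ∀ i, ContDiff ℝ ∞ (χ i)) (h2 : ∀ i, HasCompactSupport (χ i))
    (hs : ∀ x ∈ Ω, ∑ i, χ i x = 1) (p : WithLp 2 (L2 Ω × L2Vec Ω)) :
    ∑ i, cutoffPair (h1 i) (h2 i) p = p := by
  -- The cutoffs sum to 1 on an open set, so their derivatives cancel there.
  have hd : ∀ x ∈ Ω, ∀ j, ∑ i, partialDeriv j (χ i) x = 0 := fun x hx j => by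
    have hsum : HasFDerivAt (fun x => ∑ i, χ i x) (∑ i, fderiv ℝ (χ i) x) x :=
      HasFDerivAt.fun_sum fun i _ => ((h1 i).differentiable (by simp)).differentiableAt.hasFDerivAt
    have hone : (fun x => ∑ i, χ i x) =ᶠ[𝓝 x] fun _ => 1 :=
      Filter.mem_of_superset (hΩ.mem_nhds hx) hs
    have h0 := hsum.unique ((hasFDerivAt_const (1 : ℝ) x).congr_of_eventuallyEq hone)
    simpa [partialDeriv] using congrArg (fun A : E3 →L[ℝ] ℝ => A (EuclideanSpace.single j 1)) h0
  apply WithLp.ofLp_injective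
  have hΩae : ∀ᵐ x ∂(volume.restrict Ω), x ∈ Ω := ae_restrict_mem hΩ.measurableSet
  have hof : WithLp.ofLp (∑ i, cutoffPair (h1 i) (h2 i) p)
      = ∑ i, WithLp.ofLp (cutoffPair (h1 i) (h2 i) p) := WithLp.ofLp_sum ..
  rw [hof]
  refine Prod.ext ?_ ?_
  · rw [Prod.fst_sum]
    refine Lp.ext ?_
    have hc : ∀ᵐ x ∂(volume.restrict Ω), ∀ i, (WithLp.ofLp (cutoffPair (h1 i) (h2 i) p)).1 x
        = χ i x • p.fst x := ae_all_iff.2 fun i => (memLp_cutoff (h1 i) (h2 i) p.fst).coeFn_toLp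
    filter_upwards [Lp_coeFn_sum Finset.univ
      fun i => (WithLp.ofLp (cutoffPair (h1 i) (h2 i) p)).1, hc, hΩae] with x hx hx' hxΩ
    rw [hx]
    simp only [hx']
    rw [← Finset.sum_smul, hs x hxΩ, one_smul]
    rfl
  · rw [Prod.snd_sum]
    refine Lp.ext ?_
    have hc : ∀ᵐ x ∂(volume.restrict Ω), ∀ i, (WithLp.ofLp (cutoffPair (h1 i) (h2 i) p)).2 x
        = cutoffGrad (χ i) p.fst p.snd x := ae_all_iff.2 fun i =>
          (memLp_cutoffGrad (h1 i) (h2 i) (Lp.memLp p.fst) (Lp.memLp p.snd)).coeFn_toLp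
    filter_upwards [Lp_coeFn_sum Finset.univ
      fun i => (WithLp.ofLp (cutoffPair (h1 i) (h2 i) p)).2, hc, hΩae] with x hx hx' hxΩ
    rw [hx]
    simp only [hx', cutoffGrad]
    rw [Finset.sum_add_distrib, ← Finset.sum_smul, hs x hxΩ, one_smul]
    have : ∑ i, (WithLp.toLp 2 fun j => partialDeriv j (χ i) x • p.fst x : C3) = 0 := by
      ext j
      simp only [WithLp.ofLp_sum, Finset.sum_apply, PiLp.zero_apply]
      rw [← Finset.sum_smul, hd x hxΩ j, zero_smul]
    rw [this, add_zero]
    rfl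

/-- The closure is taken in the ambient product, so membership of the cut-off pair in `H1 Ω` is
never required. -/
theorem cutoffPair_mem_closure {Ω : Set E3} (hΩ : IsBoundedLipschitzDomain Ω) {χ : E3 → ℝ}
    (h1 : ContDiff ℝ ∞ χ) (h2 : HasCompactSupport χ) (p : WithLp 2 (L2 Ω × L2Vec Ω))
    (h : ∀ ε : ℝ≥0∞, ε ≠ 0 → ∃ φ : E3 → ℂ, ContDiff ℝ ∞ φ ∧ HasCompactSupport φ ∧
        eLpNorm (fun y => φ y - χ y • p.fst y) 2 (volume.restrict Ω) ≤ ε ∧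
        eLpNorm (fun y => classicalGrad φ y - cutoffGrad χ p.fst p.snd y) 2
          (volume.restrict Ω) ≤ ε) :
    cutoffPair h1 h2 p ∈
      (LinearMap.range ((H1 Ω).subtype ∘ₗ smoothToH1 Ω)).topologicalClosure := by
  rw [← SetLike.mem_coe, Submodule.topologicalClosure_coe, Metric.mem_closure_iff]
  intro ε hε
  obtain ⟨φ, hφ, hφc, e1, e2⟩ := h (ENNReal.ofReal (ε / 4)) (by simpa using hε)
  let Φ : SmoothFun Ω := ⟨φ, hφ, hφc, memLp_surfaceMeasure hΩ hφ hφc⟩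
  refine ⟨_, ⟨Φ, rfl⟩, ?_⟩
  have t1 : (((H1 Ω).subtype ∘ₗ smoothToH1 Ω) Φ) = WithLp.toLp 2
    ((memLp_smooth Φ).toLp φ, (memLp_classicalGrad Φ).toLp (classicalGrad φ)) := rfl
  rw [t1, dist_comm, WithLp.prod_dist_eq_of_L2]
  have d1 : dist ((memLp_smooth Φ).toLp φ) ((memLp_cutoff h1 h2 p.fst).toLp _) ≤ ε / 4 := by
    rw [Lp.dist_edist, Lp.edist_toLp_toLp]
    exact ENNReal.toReal_le_of_le_ofReal (by positivity) e1
  have d2 : dist ((memLp_classicalGrad Φ).toLp (classicalGrad φ))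
      ((memLp_cutoffGrad h1 h2 (Lp.memLp p.fst) (Lp.memLp p.snd)).toLp _) ≤ ε / 4 := by
    rw [Lp.dist_edist, Lp.edist_toLp_toLp]
    exact ENNReal.toReal_le_of_le_ofReal (by positivity) e2
  refine (Real.sqrt_lt' hε).2 ?_
  have s1 := pow_le_pow_left₀ dist_nonneg d1 2
  have s2 := pow_le_pow_left₀ dist_nonneg d2 2
  refine (add_le_add s1 s2).trans_lt ?_
  nlinarith

theorem denseRange_smoothToH1 {Ω : Set E3} (hΩ : IsBoundedLipschitzDomain Ω) :
    DenseRange (smoothToH1 Ω) := by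
  choose! U hUo hUx hU using fun x (hx : x ∈ closure Ω) => exists_smooth_approx_cutoff hΩ hx
  obtain ⟨t, χ, htK, hχ, hχU, hsum⟩ := exists_finite_smooth_partition
    -- Intersecting with unit balls forces the cutoffs to have compact support.
    hΩ.isBounded.isCompact_closure (U := fun x => U x ∩ Metric.ball x 1)
    fun x hx => ⟨(hUo x hx).inter Metric.isOpen_ball, hUx x hx, Metric.mem_ball_self one_pos⟩
  have hχc : ∀ i, HasCompactSupport (χ i) := fun i =>
    (isCompact_closedBall (i : E3) 1).of_isClosed_subset (isClosed_tsupport _)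
      ((hχU i).trans (inter_subset_right.trans Metric.ball_subset_closedBall))
  intro p
  have hp : (p : WithLp 2 (L2 Ω × L2Vec Ω)) ∈
      (LinearMap.range ((H1 Ω).subtype ∘ₗ smoothToH1 Ω)).topologicalClosure := by
    rw [← sum_cutoffPair hΩ.isOpen hχ hχc (fun x hx => hsum x (subset_closure hx)) p.1]
    exact Submodule.sum_mem _ fun i _ => cutoffPair_mem_closure hΩ (hχ i) (hχc i) p.1
      (hU i (htK i) (χ i) (hχ i) (hχc i) ((hχU i).trans inter_subset_left) _ _ p.2)
  rw [closure_subtype]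
  rw [← SetLike.mem_coe, Submodule.topologicalClosure_coe] at hp
  rwa [LinearMap.range_comp, Submodule.map_coe] at hp

/-! ### The trace inequality on H¹(Ω) and conclusion. -/

theorem exists_trace_bound_H1 {Ω : Set E3} (hΩ : IsBoundedLipschitzDomain Ω) :
    ∃ C : ℝ, 0 < C ∧ ∀ u : H1 Ω,
      ‖trace Ω u‖ ^ 2 ≤ C * (‖val Ω u‖ ^ 2 + ‖val Ω u‖ * ‖grad Ω u‖) := by
  obtain ⟨C, hC, h⟩ := exists_trace_bound hΩ
  have hd := denseRange_smoothToH1 hΩ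
  refine ⟨C, hC, fun u => ?_⟩
  -- Together with density, this bound identifies `trace` with restriction on smooth functions; the
  -- inequality then extends because both sides are continuous.
  have hb : ∃ D, ∀ φ, ‖smoothToBdry Ω φ‖ ≤ D * ‖smoothToH1 Ω φ‖ := by
    refine ⟨Real.sqrt (2 * C), fun φ => ?_⟩
    rw [← Real.sqrt_sq (norm_nonneg (smoothToH1 Ω φ)), ← Real.sqrt_mul (by positivity)]
    refine Real.le_sqrt_of_sq_le ((h φ).trans ?_)
    rw [norm_sq_eq, mul_comm 2 C, mul_assoc]
    gcongr
    nlinarith [sq_nonneg (‖val Ω (smoothToH1 Ω φ)‖ - ‖grad Ω (smoothToH1 Ω φ)‖),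
      sq_nonneg ‖grad Ω (smoothToH1 Ω φ)‖, sq_nonneg ‖val Ω (smoothToH1 Ω φ)‖]
  refine hd.induction_on (p := fun u =>
    ‖trace Ω u‖ ^ 2 ≤ C * (‖val Ω u‖ ^ 2 + ‖val Ω u‖ * ‖grad Ω u‖)) u
    (isClosed_le (by fun_prop) (by fun_prop)) fun φ => ?_
  rw [trace, LinearMap.extendOfNorm_eq hd hb]
  exact h φ

end HelmholtzRobin

theorem mainTheorem2 (Ω : Set HelmholtzRobin.E3)
    (hΩ : HelmholtzRobin.IsBoundedLipschitzDomain Ω) :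
    ∃ C : ℝ, 0 < C ∧ ∀ ζ : ℂ, 0 < ζ.re → 1 ≤ ‖ζ‖ →
      ENNReal.ofReal (ζ.re / ‖ζ‖) ≤ HelmholtzRobin.infSupConst Ω ζ ∧
      (∀ F : HelmholtzRobin.H1 Ω →L⋆[ℂ] ℂ,
        ∃! u : HelmholtzRobin.H1 Ω, HelmholtzRobin.IsSolution Ω ζ F u) ∧
      (∀ (f : HelmholtzRobin.L2 Ω) (g : HelmholtzRobin.L2Bdry Ω) (u : HelmholtzRobin.H1 Ω),
        HelmholtzRobin.IsSolution Ω ζ (HelmholtzRobin.dataFunctional Ω f g) u →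
        HelmholtzRobin.weightedNorm Ω ‖ζ‖ u ≤
          (1 / ζ.re) * (‖f‖ + C * Real.sqrt ‖ζ‖ * ‖g‖)) := by
  obtain ⟨C, hC, hT⟩ := HelmholtzRobin.exists_trace_bound_H1 hΩ
  exact ⟨Real.sqrt (2 * C), by positivity, fun ζ h0 h1 =>
    ⟨HelmholtzRobin.le_infSupConst Ω h1, HelmholtzRobin.existsUnique_isSolution Ω h0 h1,
      HelmholtzRobin.weightedNorm_le_of_isSolution Ω hC hT h0 h1⟩⟩
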